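/- Let $X=(X_t)_{t\ge 0}$ be a Lévy subordinator (nondecreasing right-continuous paths, $X_0=0$, stationary independent increments) such that for every $t>0$ the Laplace transform $\phi_{X_t}(u)=\mathsf{E}e^{-uX_t}$ is defined for $u$ in a complex neighbourhood of the origin. For a random variable $W$ with this property the cumulants $K_W(m)$, $m\ge 0$, are the coefficients in $\log\phi_W(u)=\sum_{m\ge0}(-u)^mK_W(m)/m!$ for $u$ near $0$; write $K_t(m)=K_{X_t}(m)$. Regulated clocks of integer degree $n\ge1$. Type I: put $\bar X^{(0)}=X$ and $\bar X^{(n)}_t=\frac1t\int_0^t\bar X^{(n-1)}_s\,ds$ for $t>0$, $\bar X^{(n)}_0=0$; $X^{(n)}$ is a Lévy process with $X^{(n)}_t\overset{d}{=}\bar X^{(n)}_t$ for all $t\ge0$. Type II: put $Y^{(0)}=X$ and $\tilde X^{(n)}_t=\frac1t\int_0^tY^{(n-1)}_s\,ds$ for $t>0$, $\tilde X^{(n)}_0=0$, where $Y^{(n)}$ is a Lévy process with $Y^{(n)}_t\overset{d}{=}\tilde X^{(n)}_t$ for all $t\ge0$. Type III: $\breve X^{(n)}_t=t^{-n}$ times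 the $n$-fold iterated integral of $X$ from $0$ to $t$ for $t>0$, $\breve X^{(n)}_0=0$; $Z^{(n)}$ is a Lévy process with $Z^{(n)}_t\overset{d}{=}\breve X^{(n)}_t$ for all $t\ge0$. For real degree $n>0$, the variable at time $t>0$ of the clock of type I, II, III is a nonnegative random variable whose Laplace transform at $u\ge0$ is, respectively, $$\exp\Big(t\int_0^1\log\phi_{X_1}\big((1-\tfrac{\Gamma(n,-\log s)}{\Gamma(n)})u\big)ds\Big),\quad \exp\Big(\tfrac{t}{\Gamma(n)}\int_0^1(-\log v)^{n-1}\log\phi_{X_1}(uv)\,dv\Big),\quad \exp\Big(t\int_0^1\log\phi_{X_1}\big(\tfrac{s^nu}{\Gamma(n+1)}\big)ds\Big),$$ where $\Gamma(n,x)=\int_x^\infty y^{n-1}e^{-y}\,dy$. For types I and III one may also take the fractional averages $\frac{1}{t\Gamma(n)}\int_0^tX_s\log^{n-1}(t/s)\,ds$ and $\frac{1}{t^n\Gamma(n)}\int_0^t(t-s)^{n-1}X_s\,ds$. Then for every $t>0$ the log-Laplace transform of $X_t$ and, for every degree $n>0$ and under each of the above descriptions (for the averaged processes as well as for the induced Lévy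 processes), those of the regulated clocks of the three types at time $t$ have such an expansion near the origin, and the cumulants $\bar K^{(n)}_t,\tilde K^{(n)}_t,\breve K^{(n)}_t$ of types I, II, III satisfy for all integers $m\ge1$ $$\bar K^{(n)}_t(m)=C_{m,n}K_t(m),\qquad \tilde K^{(n)}_t(m)=\frac{K_t(m)}{(m+1)^n},\qquad \breve K^{(n)}_t(m)=\frac{K_t(m)}{(mn+1)\Gamma(n+1)^m},$$ where $$C_{m,n}=\int_0^1\Big(1-\frac{\Gamma(n,-\log s)}{\Gamma(n)}\Big)^m ds .$$ Moreover $C_{m,n}$ is rational for all integers $m,n\ge1$. -/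

import Mathlib

open MeasureTheory ProbabilityTheory Set Filter Topology
open scoped NNReal

universe u v w

namespace RegulatedClock

/-- A Lévy subordinator `X = (X_t)_{t ≥ 0}`: it starts at `0`, has independent and stationary
increments, and almost surely nondecreasing, right-continuous paths with left limits (the left
limits exist by monotonicity). -/
structure IsLevySubordinator {Ω : Type u} [MeasurableSpace Ω] (X : ℝ≥0 → Ω → ℝ)
    (P : Measure Ω) : Prop where
  measurable : ∀ t, Measurable (X t)
  start : ∀ᵐ ω ∂P, X 0 ω = 0
  indep : HasIndepIncrements X P
  stationary : ∀ s h : ℝ≥0, IdentDistrib (fun ω => X (s + h) ω - X s ω) (X h) P P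
  monotone : ∀ᵐ ω ∂P, Monotone (fun t => X t ω)
  rightCts : ∀ᵐ ω ∂P, ∀ t : ℝ≥0, ContinuousWithinAt (fun s => X s ω) (Ici t) t

section Cumulants

variable {Ω : Type u} [MeasurableSpace Ω]

/-- The Laplace transform `φ_W(u) = E e^{-uW}` at a complex argument. -/
noncomputable def laplace (W : Ω → ℝ) (P : Measure Ω) (z : ℂ) : ℂ :=
  ∫ ω, Complex.exp (-z * (W ω : ℂ)) ∂P

/-- `E e^{-uW}` is defined for all `u` in a complex neighbourhood of the origin. -/
def LaplaceDefinedNearZero (W : Ω → ℝ) (P : Measure Ω) : Prop :=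
  ∃ ε : ℝ, 0 < ε ∧ ∀ z : ℂ, ‖z‖ < ε → Integrable (fun ω => Complex.exp (-z * (W ω : ℂ))) P

/-- The `m`-th cumulant of `W`: the `m`-th derivative at `0` of the cumulant generating function
`log E e^{uW}`, that is, `K(m)` in `log φ_W(u) = ∑ (-u)^m K(m) / m!`. -/
noncomputable def cumulant (W : Ω → ℝ) (P : Measure Ω) (m : ℕ) : ℝ :=
  iteratedDeriv m (cgf W P) 0

/-- The Laplace transform of `W` is defined near the origin and
`log φ_W(u) = ∑_{m ≥ 0} (-u)^m K(m) / m!` there, `K(m)` being the cumulants of `W`. -/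
def HasCumulantExpansion (W : Ω → ℝ) (P : Measure Ω) : Prop :=
  ∃ ε : ℝ, 0 < ε ∧ ∀ z : ℂ, ‖z‖ < ε →
    Integrable (fun ω => Complex.exp (-z * (W ω : ℂ))) P ∧
    HasSum (fun m : ℕ => (-z) ^ m * (cumulant W P m : ℂ) / (m.factorial : ℂ))
      (Complex.log (laplace W P z))

/-- All cumulants of `W` exist (through the expansion of its log-Laplace transform), and for every
`m ≥ 1` the `m`-th one is `c m` times the `m`-th cumulant of `V`. -/
def HasScaledCumulants {Ω' : Type v} [MeasurableSpace Ω'] (W : Ω' → ℝ) (P' : Measure Ω')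
    (V : Ω → ℝ) (P : Measure Ω) (c : ℕ → ℝ) : Prop :=
  HasCumulantExpansion W P' ∧
    ∀ m : ℕ, 1 ≤ m → cumulant W P' m = c m * cumulant V P m

end Cumulants

section Kernels

/-- The upper incomplete gamma function `Γ(n, x) = ∫_x^∞ y^{n-1} e^{-y} dy`. -/
noncomputable def upperGamma (n x : ℝ) : ℝ :=
  ∫ y in Ioi x, y ^ (n - 1) * Real.exp (-y)

/-- `1 - Γ(n, -log s) / Γ(n)`. -/
noncomputable def kernelI (n s : ℝ) : ℝ :=
  1 - upperGamma n (-Real.log s) / Real.Gamma n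

/-- `C_{m,n} = ∫_0^1 (1 - Γ(n, -log s) / Γ(n))^m ds`. -/
noncomputable def coeffI (n : ℝ) (m : ℕ) : ℝ :=
  ∫ s in (0 : ℝ)..1, kernelI n s ^ m

/-- `(m + 1)^{-n}`. -/
noncomputable def coeffII (n : ℝ) (m : ℕ) : ℝ :=
  1 / ((m : ℝ) + 1) ^ n

/-- `1 / ((m n + 1) Γ(n + 1)^m)`. -/
noncomputable def coeffIII (n : ℝ) (m : ℕ) : ℝ :=
  1 / (((m : ℝ) * n + 1) * Real.Gamma (n + 1) ^ m)

end Kernels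

section Recipes

variable {Ω : Type u} [MeasurableSpace Ω]

/-- The pathwise integral `t ↦ ∫_0^t Z_s ds`. -/
noncomputable def timeIntegral (Z : ℝ≥0 → Ω → ℝ) : ℝ≥0 → Ω → ℝ :=
  fun t ω => ∫ s in (0 : ℝ)..(t : ℝ), Z s.toNNReal ω

/-- The running average `t ↦ (1/t) ∫_0^t Z_s ds`, with value `0` at `t = 0`. -/
noncomputable def runningAverage (Z : ℝ≥0 → Ω → ℝ) : ℝ≥0 → Ω → ℝ :=
  fun t ω => (t : ℝ)⁻¹ * timeIntegral Z t ω

/-- First recipe: the `n`-fold iterated running average of the paths. -/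
noncomputable def averageI (X : ℝ≥0 → Ω → ℝ) (n : ℕ) : ℝ≥0 → Ω → ℝ :=
  runningAverage^[n] X

/-- Third recipe: `t^{-n}` times the `n`-fold iterated integral of the paths. -/
noncomputable def averageIII (X : ℝ≥0 → Ω → ℝ) (n : ℕ) : ℝ≥0 → Ω → ℝ :=
  fun t ω => ((t : ℝ) ^ n)⁻¹ * (timeIntegral^[n] X) t ω

/-- `W` is a Lévy process (a subordinator) induced by the process `A`: `W_t` and `A_t` have the same
distribution for every `t ≥ 0`. -/
structure IsInducedClock {Ω' : Type v} [MeasurableSpace Ω'] (W : ℝ≥0 → Ω' → ℝ) (P' : Measure Ω')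
    (A : ℝ≥0 → Ω → ℝ) (P : Measure Ω) : Prop where
  levy : IsLevySubordinator W P'
  law : ∀ t, IdentDistrib (W t) (A t) P' P

/-- Second recipe: a sequence of Lévy subordinators, each one possibly on a probability space of its
own, in which `Y 0` is `X` in law and `Y (n + 1)` is induced by the running average of `Y n`. -/
structure IsRecipeII {Ω' : ℕ → Type v} [∀ n, MeasurableSpace (Ω' n)]
    (Y : ∀ n, ℝ≥0 → Ω' n → ℝ) (P' : ∀ n, Measure (Ω' n))
    (X : ℝ≥0 → Ω → ℝ) (P : Measure Ω) : Prop where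
  zero : IsInducedClock (Y 0) (P' 0) X P
  succ : ∀ n, IsInducedClock (Y (n + 1)) (P' (n + 1)) (runningAverage (Y n)) (P' n)

end Recipes

section Fractional

variable {Ω : Type u} [MeasurableSpace Ω]

/-- The first recipe at a real degree `n > 0`:
`(1 / (t Γ(n))) ∫_0^t X_s log^{n-1}(t/s) ds`. -/
noncomputable def fracAverageI (X : ℝ≥0 → Ω → ℝ) (n : ℝ) : ℝ≥0 → Ω → ℝ :=
  fun t ω => ((t : ℝ) * Real.Gamma n)⁻¹ *
    ∫ s in (0 : ℝ)..(t : ℝ), X s.toNNReal ω * Real.log ((t : ℝ) / s) ^ (n - 1)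

/-- The third recipe at a real degree `n > 0`: `t^{-n}` times the Riemann--Liouville integral
`(1 / Γ(n)) ∫_0^t (t - s)^{n-1} X_s ds`. -/
noncomputable def fracAverageIII (X : ℝ≥0 → Ω → ℝ) (n : ℝ) : ℝ≥0 → Ω → ℝ :=
  fun t ω => ((t : ℝ) ^ n * Real.Gamma n)⁻¹ *
    ∫ s in (0 : ℝ)..(t : ℝ), ((t : ℝ) - s) ^ (n - 1) * X s.toNNReal ω

/-! A nonnegative random variable `W` has the law of the type I, II or III regulated `X`-clock of
real degree `n > 0` at time `t` if its Laplace transform is the one displayed. On real `u ≥ 0`,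
which is all that is required, `mgf W P' (-u)` is `E e^{-uW}` and `cgf (X 1) P (-u)` is the real
logarithm of `E e^{-uX_1}`. -/

variable {Ω' : Type v} [MeasurableSpace Ω']

/-- `E e^{-uW} = exp (t ∫_0^1 log φ_{X_1}((1 - Γ(n, -log s)/Γ(n)) u) ds)`. -/
structure HasLawI (W : Ω' → ℝ) (P' : Measure Ω') (X : ℝ≥0 → Ω → ℝ) (P : Measure Ω)
    (n : ℝ) (t : ℝ≥0) : Prop where
  aemeasurable : AEMeasurable W P'
  nonneg : ∀ᵐ ω ∂P', 0 ≤ W ω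
  laplace_eq : ∀ x : ℝ, 0 ≤ x →
    mgf W P' (-x) =
      Real.exp ((t : ℝ) * ∫ s in (0 : ℝ)..1, cgf (X 1) P (-(kernelI n s * x)))

/-- `E e^{-uW} = exp ((t/Γ(n)) ∫_0^1 (-log v)^{n-1} log φ_{X_1}(u v) dv)`. -/
structure HasLawII (W : Ω' → ℝ) (P' : Measure Ω') (X : ℝ≥0 → Ω → ℝ) (P : Measure Ω)
    (n : ℝ) (t : ℝ≥0) : Prop where
  aemeasurable : AEMeasurable W P'
  nonneg : ∀ᵐ ω ∂P', 0 ≤ W ω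
  laplace_eq : ∀ x : ℝ, 0 ≤ x →
    mgf W P' (-x) =
      Real.exp ((t : ℝ) / Real.Gamma n *
        ∫ s in (0 : ℝ)..1, (-Real.log s) ^ (n - 1) * cgf (X 1) P (-(x * s)))

/-- `E e^{-uW} = exp (t ∫_0^1 log φ_{X_1}(s^n u / Γ(n+1)) ds)`. -/
structure HasLawIII (W : Ω' → ℝ) (P' : Measure Ω') (X : ℝ≥0 → Ω → ℝ) (P : Measure Ω)
    (n : ℝ) (t : ℝ≥0) : Prop where
  aemeasurable : AEMeasurable W P'
  nonneg : ∀ᵐ ω ∂P', 0 ≤ W ω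
  laplace_eq : ∀ x : ℝ, 0 ≤ x →
    mgf W P' (-x) =
      Real.exp ((t : ℝ) * ∫ s in (0 : ℝ)..1, cgf (X 1) P (-(s ^ n * x / Real.Gamma (n + 1))))

end Fractional

end RegulatedClock

/-! A regulated clock at time `t` is a weighted average `∫_0^1 X_{ts} w(s) ds` of a path, or is
prescribed by the Laplace transform that such averages suggest. Summation by parts rewrites the
average as `∫ G(s) dX_{ts}` with `G(s) = ∫_s^1 w`. Independent increments and linearity of the
Laplace exponent in time then give `E e^{-uA} = exp(t ∫_0^1 log φ_{X_1}(G(s)u) ds)`; this is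
`mgf_weightedAverage`, proved by discretization. For type I, `G` is `kernelI n`; for type III it is
`(1-s)^n/Γ(n+1)`.

Every log-Laplace transform involved is thus a mixture of dilations of that of `X_1`. A mixture
multiplies the `m`-th Taylor coefficient by the `m`-th moment of the dilation factor
(`analyticAt_integral_dilation`), and these moments are the three families of coefficients.

The laws are given only for `u ≥ 0`, so exponential moments must first be produced. Fatou's lemma
bounds each moment by a derivative at `0` of the analytic continuation, and summing the exponential
series makes `E e^{rW}` finite for some `r > 0`. The identity theorem then identifies `cgf` near
`0`, and once more extends the expansion to complex arguments (`cumulant_of_mgf_eq_mixture`).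

At integer degrees, iterated averages of types I and III equal the fractional ones by Fubini. Type
II is an induction in which each average divides the `m`-th cumulant by `m + 1`. Rationality holds
because `kernelI n` is then a polynomial in `s` and `log s` with rational coefficients. -/

namespace RegulatedClock

/-! ### Taylor coefficients and mixtures of dilations. -/

section PowerSeries

variable {𝕜 : Type*} [RCLike 𝕜]

theorem exists_hasSum_of_analyticAt {f : 𝕜 → 𝕜} (hf : AnalyticAt 𝕜 f 0) :
    ∃ r : ℝ, 0 < r ∧ ∀ z : 𝕜, ‖z‖ < r →
      HasSum (fun n : ℕ => z ^ n * (iteratedDeriv n f 0 / (n.factorial : 𝕜))) (f z) := by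
  have h := hf.hasFPowerSeriesAt
  rw [hasFPowerSeriesAt_iff] at h
  obtain ⟨r, hr, h⟩ := Metric.eventually_nhds_iff.1 h
  refine ⟨r, hr, fun z hz => ?_⟩
  have := h (y := z) (by simpa using hz)
  simpa [FormalMultilinearSeries.coeff_ofScalars] using this

theorem hasFPowerSeriesAt_of_hasSum {f : 𝕜 → 𝕜} {a : ℕ → 𝕜} {r : ℝ} (hr : 0 < r)
    (h : ∀ z : 𝕜, ‖z‖ < r → HasSum (fun n : ℕ => z ^ n * a n) (f z)) :
    HasFPowerSeriesAt f (FormalMultilinearSeries.ofScalars 𝕜 a) 0 := by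
  rw [hasFPowerSeriesAt_iff]
  refine Metric.eventually_nhds_iff.2 ⟨r, hr, fun z hz => ?_⟩
  simpa [FormalMultilinearSeries.coeff_ofScalars] using h z (by simpa using hz)

theorem iteratedDeriv_of_hasSum {f : 𝕜 → 𝕜} {a : ℕ → 𝕜} {r : ℝ} (hr : 0 < r)
    (h : ∀ z : 𝕜, ‖z‖ < r → HasSum (fun n : ℕ => z ^ n * a n) (f z)) (m : ℕ) :
    iteratedDeriv m f 0 = (m.factorial : 𝕜) * a m := by
  have h1 := hasFPowerSeriesAt_of_hasSum hr h
  have h2 := h1.analyticAt.hasFPowerSeriesAt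
  have h3 := congrArg (fun p => p.coeff m) (h1.eq_formalMultilinearSeries h2)
  simp only [FormalMultilinearSeries.coeff_ofScalars] at h3
  have : (m.factorial : 𝕜) ≠ 0 := by exact_mod_cast m.factorial_ne_zero
  rw [h3]
  field_simp

/-- Averaging the dilations `θ ↦ f (θ g)` of an analytic function multiplies its Taylor
coefficients by the moments of the dilation factor. -/
theorem analyticAt_integral_dilation {S : Type*} [MeasurableSpace S] {μ : Measure S}
    {w g : S → ℝ} {M : ℝ} (hw : Integrable w μ) (hg : AEStronglyMeasurable g μ)
    (hM : ∀ᵐ s ∂μ, |g s| ≤ M) {f : ℝ → ℝ} (hf : AnalyticAt ℝ f 0) :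
    AnalyticAt ℝ (fun θ => ∫ s, w s * f (θ * g s) ∂μ) 0 ∧
      ∀ m : ℕ, iteratedDeriv m (fun θ => ∫ s, w s * f (θ * g s) ∂μ) 0 =
        (∫ s, w s * g s ^ m ∂μ) * iteratedDeriv m f 0 := by
  obtain ⟨r, hr, hsum⟩ := exists_hasSum_of_analyticAt hf
  set a : ℕ → ℝ := fun n => iteratedDeriv n f 0 / (n.factorial : ℝ) with ha
  -- The `+ 1` keeps `K` positive even if `M = 0`, so `r / K` is a usable radius.
  set K : ℝ := |M| + 1 with hK
  have hK0 : 0 < K := by positivity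
  have hgK : ∀ᵐ s ∂μ, |g s| ≤ K := hM.mono fun s hs => by
    have := le_abs_self M; simp only [hK]; linarith
  have hint : ∀ n : ℕ, Integrable (fun s => w s * g s ^ n) μ := fun n => by
    refine hw.mul_bdd (c := K ^ n) (hg.pow n) (hgK.mono fun s hs => ?_)
    simpa [abs_pow] using pow_le_pow_left₀ (abs_nonneg _) hs n
  have key : ∀ θ : ℝ, ‖θ‖ < r / K →
      HasSum (fun n : ℕ => θ ^ n * (a n * ∫ s, w s * g s ^ n ∂μ))
        (∫ s, w s * f (θ * g s) ∂μ) := by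
    intro θ hθ
    have hθK : |θ| * K < r := by rwa [Real.norm_eq_abs, lt_div_iff₀ hK0] at hθ
    have hF := hasSum_integral_of_summable_integral_norm
      (F := fun (n : ℕ) s => (θ ^ n * a n) * (w s * g s ^ n)) (μ := μ)
      (fun n => (hint n).const_mul _) ?_
    · convert! hF using 1
      · ext n
        rw [integral_const_mul]
        ring
      · refine integral_congr_ae (hgK.mono fun s hs => ?_)
        have h1 : ‖θ * g s‖ < r := by
          rw [norm_mul]
          refine lt_of_le_of_lt ?_ hθK
          exact mul_le_mul_of_nonneg_left hs (abs_nonneg _)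
        have h2 := ((hsum _ h1).mul_left (w s)).tsum_eq
        simp only
        rw [← h2]
        congr 1
        ext n
        simp only [ha]
        ring
    -- Termwise integration is dominated by the Taylor series of `f` at `|θ| * K`, which lies inside
    -- the radius `r`, times the `L¹` norm of `w`.
    · have hs : Summable fun n : ℕ => |(|θ| * K) ^ n * a n| * ∫ s, |w s| ∂μ := by
        have := (hsum (|θ| * K) (by
          rw [Real.norm_of_nonneg (by positivity)]; exact hθK)).summable.abs
        exact this.mul_right _
      refine Summable.of_nonneg_of_le (fun n => integral_nonneg fun s => norm_nonneg _)
        (fun n => ?_) hs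
      rw [← integral_const_mul]
      refine integral_mono_ae ((hint n).const_mul _).norm (hw.abs.const_mul _)
        (hgK.mono fun s hs => ?_)
      have : |g s| ^ n ≤ K ^ n := pow_le_pow_left₀ (abs_nonneg _) hs n
      simp only [Real.norm_eq_abs, abs_mul, abs_pow, abs_abs, abs_of_pos hK0, mul_pow]
      calc |θ| ^ n * |a n| * (|w s| * |g s| ^ n)
          ≤ |θ| ^ n * |a n| * (|w s| * K ^ n) := by gcongr
        _ = _ := by ring
  refine ⟨(hasFPowerSeriesAt_of_hasSum (by positivity) key).analyticAt, fun m => ?_⟩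
  rw [iteratedDeriv_of_hasSum (by positivity) key m]
  have : (m.factorial : ℝ) ≠ 0 := by exact_mod_cast m.factorial_ne_zero
  simp only [ha]
  field_simp

end PowerSeries

/-! ### Exponential moments and cumulant expansions. -/

theorem LaplaceDefinedNearZero.zero_mem_interior {Ω : Type u} [MeasurableSpace Ω] {P : Measure Ω}
    {W : Ω → ℝ} (h : LaplaceDefinedNearZero W P) :
    0 ∈ interior (integrableExpSet W P) := by
  obtain ⟨ε, hε, h⟩ := h
  rw [mem_interior_iff_mem_nhds]
  refine mem_of_superset (Metric.ball_mem_nhds 0 hε) fun x hx => ?_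
  have := (h (-(x : ℂ)) (by simpa using hx)).norm
  refine this.congr (Eventually.of_forall fun ω => ?_)
  simp [Complex.norm_exp]

theorem HasCumulantExpansion.laplaceDefinedNearZero {Ω : Type u} [MeasurableSpace Ω] {P : Measure Ω}
    {W : Ω → ℝ} (h : HasCumulantExpansion W P) :
    LaplaceDefinedNearZero W P := by
  obtain ⟨ε, hε, h⟩ := h
  exact ⟨ε, hε, fun z hz => (h z hz).1⟩

section Moments

variable {Ω : Type u} [MeasurableSpace Ω] {P : Measure Ω} [IsProbabilityMeasure P] {W : Ω → ℝ}

theorem mem_integrableExpSet_of_nonpos (hW : AEMeasurable W P) (hW0 : ∀ᵐ ω ∂P, 0 ≤ W ω)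
    {x : ℝ} (hx : x ≤ 0) : x ∈ integrableExpSet W P := by
  refine Integrable.of_bound (C := 1) (by fun_prop) (hW0.mono fun ω hω => ?_)
  rw [Real.norm_eq_abs, Real.abs_exp, Real.exp_le_one_iff]
  exact mul_nonpos_of_nonpos_of_nonneg hx hω

/-- At `x < 0` the `m`-th derivative of `F` is `E[W^m e^{xW}]`. As `x` increases to `0` the
derivative converges by analyticity, and Fatou's lemma bounds the moment without presupposing that
it is finite. -/
theorem lintegral_pow_le_of_mgf_eq (hW : AEMeasurable W P) (hW0 : ∀ᵐ ω ∂P, 0 ≤ W ω)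
    {F : ℝ → ℝ} (hF : AnalyticAt ℝ F 0) (h : ∀ x < 0, mgf W P x = F x) (m : ℕ) :
    ∫⁻ ω, ENNReal.ofReal (W ω ^ m) ∂P ≤ ENNReal.ofReal (iteratedDeriv m F 0) := by
  have hint : ∀ x < 0, x ∈ interior (integrableExpSet W P) := fun x hx =>
    mem_interior_iff_mem_nhds.2 (mem_of_superset (Iio_mem_nhds hx) fun y hy =>
      mem_integrableExpSet_of_nonpos hW hW0 (le_of_lt hy))
  set x : ℕ → ℝ := fun k => -(1 / ((k : ℝ) + 1)) with hx
  have hxneg : ∀ k, x k < 0 := fun k => by simp only [hx]; rw [neg_lt_zero]; positivity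
  have hx0 : Tendsto x atTop (𝓝 0) := by
    simpa only [neg_zero] using (tendsto_one_div_add_atTop_nhds_zero_nat (𝕜 := ℝ)).neg
  have hderiv : ∀ k, ∫⁻ ω, ENNReal.ofReal (W ω ^ m * Real.exp (x k * W ω)) ∂P =
      ENNReal.ofReal (iteratedDeriv m F (x k)) := fun k => by
    have h1 : iteratedDeriv m F (x k) = iteratedDeriv m (mgf W P) (x k) := by
      refine Filter.EventuallyEq.iteratedDeriv_eq m ?_
      filter_upwards [Iio_mem_nhds (hxneg k)] with y hy using (h y hy).symm
    rw [h1, iteratedDeriv_mgf (hint _ (hxneg k)),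
      ofReal_integral_eq_lintegral_ofReal]
    · exact integrable_pow_mul_exp_of_mem_interior_integrableExpSet (hint _ (hxneg k)) m
    · exact hW0.mono fun ω hω => mul_nonneg (pow_nonneg hω m) (Real.exp_nonneg _)
  have hcont : ContinuousAt (iteratedDeriv m F) 0 := by
    rw [iteratedDeriv_eq_iterate]
    exact (hF.iterated_deriv m).continuousAt
  have hlim : Tendsto (fun k => ENNReal.ofReal (iteratedDeriv m F (x k))) atTop
      (𝓝 (ENNReal.ofReal (iteratedDeriv m F 0))) :=
    ENNReal.tendsto_ofReal (hcont.tendsto.comp hx0)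
  calc ∫⁻ ω, ENNReal.ofReal (W ω ^ m) ∂P
      = ∫⁻ ω, liminf (fun k => ENNReal.ofReal (W ω ^ m * Real.exp (x k * W ω))) atTop ∂P := by
        refine lintegral_congr fun ω => (Tendsto.liminf_eq ?_).symm
        refine ENNReal.tendsto_ofReal ?_
        have : Tendsto (fun k => W ω ^ m * Real.exp (x k * W ω)) atTop
            (𝓝 (W ω ^ m * Real.exp (0 * W ω))) :=
          ((Real.continuous_exp.tendsto _).comp (hx0.mul_const _)).const_mul _
        simpa using this
    _ ≤ liminf (fun k => ∫⁻ ω, ENNReal.ofReal (W ω ^ m * Real.exp (x k * W ω)) ∂P) atTop :=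
        lintegral_liminf_le' fun k => by fun_prop
    _ = ENNReal.ofReal (iteratedDeriv m F 0) := by
        simp_rw [hderiv]
        exact hlim.liminf_eq

/-- A nonnegative variable whose Laplace transform continues analytically through the origin has
exponential moments. -/
theorem zero_mem_interior_of_mgf_eq (hW : AEMeasurable W P) (hW0 : ∀ᵐ ω ∂P, 0 ≤ W ω)
    {F : ℝ → ℝ} (hF : AnalyticAt ℝ F 0) (h : ∀ x < 0, mgf W P x = F x) :
    0 ∈ interior (integrableExpSet W P) := by
  obtain ⟨r, hr, hsum⟩ := exists_hasSum_of_analyticAt hF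
  have hr2 : 0 < r / 2 := by positivity
  -- Expand `e^{(r/2)W}` and integrate by Tonelli: the moment bounds dominate the sum by the
  -- absolutely convergent Taylor series of `F` at `r / 2`.
  have hmem : r / 2 ∈ integrableExpSet W P := by
    refine ⟨by fun_prop, ?_⟩
    rw [hasFiniteIntegral_iff_ofReal (Eventually.of_forall fun ω => Real.exp_nonneg _)]
    have hexp : ∀ᵐ ω ∂P, ENNReal.ofReal (Real.exp (r / 2 * W ω)) =
        ∑' m : ℕ, ENNReal.ofReal ((r / 2) ^ m / m.factorial) * ENNReal.ofReal (W ω ^ m) := by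
      refine hW0.mono fun ω hω => ?_
      have h1 := NormedSpace.expSeries_div_hasSum_exp (𝔸 := ℝ) (r / 2 * W ω)
      rw [← Real.exp_eq_exp_ℝ] at h1
      rw [← h1.tsum_eq, ENNReal.ofReal_tsum_of_nonneg (fun m => by positivity) h1.summable]
      congr 1
      ext m
      rw [← ENNReal.ofReal_mul (by positivity)]
      congr 1
      rw [mul_pow]
      ring
    rw [lintegral_congr_ae hexp, lintegral_tsum (fun m => by fun_prop)]
    have hle : ∀ m : ℕ, ∫⁻ ω, ENNReal.ofReal ((r / 2) ^ m / m.factorial) *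
        ENNReal.ofReal (W ω ^ m) ∂P ≤
        ENNReal.ofReal |(r / 2) ^ m * (iteratedDeriv m F 0 / m.factorial)| := fun m => by
      rw [lintegral_const_mul'' _ (by fun_prop)]
      refine (mul_le_mul_right (lintegral_pow_le_of_mgf_eq hW hW0 hF h m) _).trans ?_
      rw [← ENNReal.ofReal_mul (by positivity)]
      refine ENNReal.ofReal_le_ofReal (le_trans (le_of_eq ?_) (le_abs_self _))
      ring
    refine (ENNReal.tsum_le_tsum hle).trans_lt ?_
    have hs := (hsum (r / 2) (by
      rw [Real.norm_of_nonneg hr2.le]; linarith)).summable.abs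
    rw [← ENNReal.ofReal_tsum_of_nonneg (fun m => abs_nonneg _) hs]
    exact ENNReal.ofReal_lt_top
  rw [mem_interior_iff_mem_nhds]
  refine mem_of_superset (Icc_mem_nhds (neg_lt_zero.2 one_pos) hr2) ?_
  exact convex_integrableExpSet.ordConnected.out
    (mem_integrableExpSet_of_nonpos hW hW0 (by norm_num)) hmem

/-- On the real axis `log E e^{zW}` is `cgf`, the sum of its Taylor series. The same coefficients
define a complex analytic function, and the identity theorem carries the equality to a complex
neighbourhood; evaluation at `-z` gives the Laplace convention. -/
theorem hasCumulantExpansion_of_mem_interior (h : 0 ∈ interior (integrableExpSet W P)) :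
    HasCumulantExpansion W P := by
  have hW : AEMeasurable W P := aemeasurable_of_mem_interior_integrableExpSet h
  have hlog : AnalyticAt ℂ (fun z => Complex.log (complexMGF W P z)) 0 := by
    refine (analyticAt_complexMGF (by simpa using h)).clog ?_
    simp [complexMGF]
  obtain ⟨r, hr, hsum⟩ := exists_hasSum_of_analyticAt (analyticAt_cgf h)
  have hsumC : ∀ z : ℂ, ‖z‖ < r →
      HasSum (fun n : ℕ => z ^ n * ((cumulant W P n / n.factorial : ℝ) : ℂ))
        (∑' n : ℕ, z ^ n * ((cumulant W P n / n.factorial : ℝ) : ℂ)) := fun z hz => by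
    refine Summable.hasSum (Summable.of_norm ?_)
    have := (hsum ‖z‖ (by simpa using hz)).summable.norm
    simpa [cumulant] using this
  have hseries := (hasFPowerSeriesAt_of_hasSum hr hsumC).analyticAt
  have hreal : ∀ x : ℝ, |x| < r → Complex.log (complexMGF W P x) =
      ∑' n : ℕ, (x : ℂ) ^ n * ((cumulant W P n / n.factorial : ℝ) : ℂ) := fun x hx => by
    rw [complexMGF_ofReal, ← Complex.ofReal_log mgf_nonneg]
    have h1 := (Complex.hasSum_ofReal.2 (hsum x (by simpa using hx))).tsum_eq
    rw [← cgf, ← h1]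
    congr 1
    ext n
    simp [cumulant]
  have hfreq : ∃ᶠ z in 𝓝[≠] (0 : ℂ), Complex.log (complexMGF W P z) =
      ∑' n : ℕ, z ^ n * ((cumulant W P n / n.factorial : ℝ) : ℂ) := by
    have ht : Tendsto (fun x : ℝ => (x : ℂ)) (𝓝[≠] 0) (𝓝[≠] 0) := by
      refine tendsto_nhdsWithin_of_tendsto_nhds_of_eventually_within _ ?_ ?_
      · exact (Complex.continuous_ofReal.tendsto' 0 0 (by simp)).mono_left nhdsWithin_le_nhds
      · filter_upwards [self_mem_nhdsWithin] with x hx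
        simpa using hx
    refine ht.frequently (Eventually.frequently ?_)
    filter_upwards [nhdsWithin_le_nhds (Metric.ball_mem_nhds (0 : ℝ) hr)] with x hx
    exact hreal x (by simpa using hx)
  have heq := (hlog.frequently_eq_iff_eventually_eq hseries).1 hfreq
  have hint : ∀ᶠ z : ℂ in 𝓝 0, z.re ∈ interior (integrableExpSet W P) :=
    Complex.continuous_re.continuousAt.eventually_mem (isOpen_interior.mem_nhds (by simpa using h))
  obtain ⟨ε, hε, hball⟩ := Metric.eventually_nhds_iff.1
    (heq.and (hint.and (Metric.ball_mem_nhds (0 : ℂ) hr)))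
  refine ⟨ε, hε, fun z hz => ?_⟩
  obtain ⟨h1, h2, h3⟩ := hball (y := -z) (by simpa using hz)
  refine ⟨?_, ?_⟩
  · exact integrable_cexp_mul_of_re_mem_interior_integrableExpSet h2
  · have h4 := hsumC (-z) (by simpa using h3)
    rw [← h1] at h4
    convert! h4 using 1
    ext n
    push_cast
    ring

/-- A nonnegative variable whose log-Laplace transform is a mixture of dilations of that of `V` has
the cumulants of `V` up to the moments of the mixing measure. -/
theorem cumulant_of_mgf_eq_mixture {Ω' : Type v} [MeasurableSpace Ω'] {P' : Measure Ω'}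
    [IsProbabilityMeasure P'] {V : Ω' → ℝ} (hV : 0 ∈ interior (integrableExpSet V P'))
    {S : Type*} [MeasurableSpace S] {μ : Measure S}
    {k g : S → ℝ} {M : ℝ} (hk : Integrable k μ) (hg : AEStronglyMeasurable g μ)
    (hM : ∀ᵐ s ∂μ, |g s| ≤ M) (hW : AEMeasurable W P) (hW0 : ∀ᵐ ω ∂P, 0 ≤ W ω) {c : ℝ}
    (h : ∀ x : ℝ, 0 ≤ x → mgf W P (-x) = Real.exp (c * ∫ s, k s * cgf V P' (-x * g s) ∂μ)) :
    HasCumulantExpansion W P ∧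
      ∀ m : ℕ, cumulant W P m = c * (∫ s, k s * g s ^ m ∂μ) * cumulant V P' m := by
  obtain ⟨hA, hD⟩ := analyticAt_integral_dilation hk hg hM (analyticAt_cgf hV)
  set Ψ : ℝ → ℝ := fun θ => ∫ s, k s * cgf V P' (θ * g s) ∂μ
  have hc : AnalyticAt ℝ (fun θ => c * Ψ θ) 0 := analyticAt_const.mul hA
  have hmgf : ∀ x ≤ 0, mgf W P x = Real.exp (c * Ψ x) := fun x hx => by
    simpa using h (-x) (by linarith)
  have h0 : 0 ∈ interior (integrableExpSet W P) :=
    zero_mem_interior_of_mgf_eq hW hW0 hc.rexp fun x hx => hmgf x hx.le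
  refine ⟨hasCumulantExpansion_of_mem_interior h0, fun m => ?_⟩
  -- The hypothesis reaches only arguments `≤ 0`, but these accumulate at `0`, as the identity
  -- theorem requires.
  have hfreq : ∃ᶠ x in 𝓝[≠] (0 : ℝ), cgf W P x = c * Ψ x := by
    have : ∃ᶠ x in 𝓝[<] (0 : ℝ), cgf W P x = c * Ψ x := by
      refine Eventually.frequently ?_
      filter_upwards [self_mem_nhdsWithin] with x hx
      rw [cgf, hmgf x (le_of_lt hx), Real.log_exp]
    exact this.filter_mono (nhdsWithin_mono _ fun x hx => ne_of_lt hx)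
  have heq : cgf W P =ᶠ[𝓝 0] fun θ => c * Ψ θ :=
    ((analyticAt_cgf h0).frequently_eq_iff_eventually_eq hc).1 hfreq
  rw [cumulant, heq.iteratedDeriv_eq m, iteratedDeriv_const_mul_field, hD m, cumulant]
  ring

end Moments

/-! ### The Laplace exponent of a subordinator. -/

section Levy

/-- Cauchy's equation with monotonicity as the regularity: squeezing `N t` between consecutive
integers gives `N |f t - t f 1| ≤ |f 1|` for every `N`. -/
theorem eq_mul_of_additive_of_antitone {f : ℝ≥0 → ℝ} (hadd : ∀ s t, f (s + t) = f s + f t)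
    (hanti : Antitone f) (t : ℝ≥0) : f t = (t : ℝ) * f 1 := by
  have h0 : f 0 = 0 := by simpa using hadd 0 0
  have hsmul : ∀ (n : ℕ) (s : ℝ≥0), f (n * s) = n * f s := fun n s => by
    induction n with
    | zero => simpa using h0
    | succ n ih => push_cast; rw [add_mul, hadd, ih, one_mul]; ring
  have hnat : ∀ n : ℕ, f n = n * f 1 := fun n => by simpa using hsmul n 1
  have hf1 : f 1 ≤ 0 := h0 ▸ hanti zero_le_one
  have hbound : ∀ N : ℕ, (N : ℝ) * |f t - t * f 1| ≤ |f 1| := fun N => by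
    have hk1 : ((⌊N * t⌋₊ : ℕ) : ℝ≥0) ≤ N * t := Nat.floor_le zero_le
    have hk2 : N * t ≤ ((⌊N * t⌋₊ + 1 : ℕ) : ℝ≥0) := by
      push_cast; exact (Nat.lt_floor_add_one _).le
    have h1 := hanti hk1
    have h2 := hanti hk2
    rw [hnat, hsmul] at h1 h2
    have hk1' : ((⌊N * t⌋₊ : ℕ) : ℝ) ≤ N * t := by exact_mod_cast hk1
    have hk2' : (N : ℝ) * t ≤ (⌊N * t⌋₊ : ℕ) + 1 := by exact_mod_cast hk2
    push_cast at h2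
    rw [← abs_of_nonneg (Nat.cast_nonneg (α := ℝ) N), ← abs_mul, abs_of_nonpos hf1, abs_le]
    constructor <;> nlinarith
  by_contra hne
  have hpos : 0 < |f t - t * f 1| := abs_pos.2 (sub_ne_zero.2 hne)
  obtain ⟨N, hN⟩ := exists_nat_gt (|f 1| / |f t - t * f 1|)
  rw [div_lt_iff₀ hpos] at hN
  exact absurd (hbound N) (not_le.2 hN)

variable {Ω : Type u} [MeasurableSpace Ω] {P : Measure Ω} [IsProbabilityMeasure P]
  {X : ℝ≥0 → Ω → ℝ}

namespace IsLevySubordinator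

theorem ae_nonneg {P : Measure Ω} (hX : IsLevySubordinator X P) :
    ∀ᵐ ω ∂P, ∀ t, 0 ≤ X t ω := by
  filter_upwards [hX.start, hX.monotone] with ω h0 hm t
  simpa [h0] using hm (zero_le (a := t))

theorem mem_integrableExpSet (hX : IsLevySubordinator X P) (t : ℝ≥0) {θ : ℝ} (hθ : θ ≤ 0) :
    θ ∈ integrableExpSet (X t) P :=
  mem_integrableExpSet_of_nonpos (hX.measurable t).aemeasurable
    (hX.ae_nonneg.mono fun _ h => h t) hθ

theorem cgf_add (hX : IsLevySubordinator X P) {θ : ℝ} (hθ : θ ≤ 0) (s h : ℝ≥0) :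
    cgf (X (s + h)) P θ = cgf (X s) P θ + cgf (X h) P θ := by
  have hind : IndepFun (X s) (X (s + h) - X s) P :=
    hX.indep.indepFun_eval_sub (r := 0) zero_le le_self_add hX.start
  have hinc : mgf (X (s + h) - X s) P θ = mgf (X h) P θ :=
    mgf_congr_of_identDistrib _ _ (hX.stationary s h) θ
  have hmgf : mgf (X (s + h)) P θ = mgf (X s) P θ * mgf (X h) P θ := by
    rw [← hinc, ← hind.mgf_add' (hX.measurable s).aestronglyMeasurable
      ((hX.measurable _).sub (hX.measurable s)).aestronglyMeasurable]
    congr 1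
    abel
  rw [cgf, hmgf, Real.log_mul (mgf_pos (hX.mem_integrableExpSet s hθ)).ne'
    (mgf_pos (hX.mem_integrableExpSet h hθ)).ne']
  rfl

/-- The Laplace exponent is linear in time. -/
theorem cgf_eq_mul (hX : IsLevySubordinator X P) {θ : ℝ} (hθ : θ ≤ 0) (t : ℝ≥0) :
    cgf (X t) P θ = t * cgf (X 1) P θ := by
  refine eq_mul_of_additive_of_antitone (f := fun t => cgf (X t) P θ) (hX.cgf_add hθ) ?_ t
  intro s t hst
  refine Real.log_le_log (mgf_pos (hX.mem_integrableExpSet t hθ)) ?_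
  refine integral_mono_ae (hX.mem_integrableExpSet t hθ) (hX.mem_integrableExpSet s hθ) ?_
  filter_upwards [hX.monotone] with ω hω
  exact Real.exp_le_exp.2 (mul_le_mul_of_nonpos_left (hω hst) hθ)

theorem mgf_eq_exp (hX : IsLevySubordinator X P) {θ : ℝ} (hθ : θ ≤ 0) (t : ℝ≥0) :
    mgf (X t) P θ = Real.exp (t * cgf (X 1) P θ) := by
  rw [← hX.cgf_eq_mul hθ, cgf, Real.exp_log (mgf_pos (hX.mem_integrableExpSet t hθ))]

end IsLevySubordinator

end Levy

/-! ### Step functions, summation by parts and Riemann sums. -/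

section RiemannSums

theorem floor_eq_of_mem_Ioo {N : ℕ} (hN : 0 < N) {k : ℕ} {s : ℝ}
    (hs : s ∈ Ioo ((k : ℝ) / N) (((k + 1 : ℕ) : ℝ) / N)) : ⌊N * s⌋₊ = k := by
  have hN' : (0 : ℝ) < N := by exact_mod_cast hN
  obtain ⟨h1, h2⟩ := hs
  rw [div_lt_iff₀ hN'] at h1
  rw [lt_div_iff₀ hN'] at h2
  rw [Nat.floor_eq_iff ((Nat.cast_nonneg k).trans (by linarith))]
  push_cast at h2
  constructor <;> linarith

/-- The floor is `k` inside the `k`-th cell; the right endpoint, where it jumps, is a null set. -/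
theorem integral_floor_mul {N : ℕ} (hN : 0 < N) (h : ℕ → ℝ) {w : ℝ → ℝ}
    (hw : IntervalIntegrable w volume 0 1) :
    ∫ s in (0 : ℝ)..1, h ⌊N * s⌋₊ * w s =
      ∑ k ∈ Finset.range N, h k * ∫ s in ((k : ℝ) / N)..(((k + 1 : ℕ) : ℝ) / N), w s := by
  have hN' : (0 : ℝ) < N := by exact_mod_cast hN
  have hle : ∀ k : ℕ, (k : ℝ) / N ≤ ((k + 1 : ℕ) : ℝ) / N := fun k => by
    gcongr; simp
  have hae : ∀ k : ℕ, ∀ᵐ s : ℝ, s ∈ uIoc ((k : ℝ) / N) (((k + 1 : ℕ) : ℝ) / N) →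
      h k * w s = h ⌊N * s⌋₊ * w s := fun k => by
    filter_upwards [compl_mem_ae_iff.2 (measure_singleton (((k + 1 : ℕ) : ℝ) / N))] with s hs hmem
    rw [uIoc_of_le (hle k)] at hmem
    rw [floor_eq_of_mem_Ioo hN ⟨hmem.1, lt_of_le_of_ne hmem.2 hs⟩]
  have hwk : ∀ k < N, IntervalIntegrable w volume ((k : ℝ) / N) (((k + 1 : ℕ) : ℝ) / N) :=
    fun k hk => by
      refine hw.mono_set ?_
      rw [uIcc_of_le (hle k), uIcc_of_le zero_le_one]
      refine Icc_subset_Icc (by positivity) ?_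
      rw [div_le_one hN']
      exact_mod_cast hk
  have hsum := intervalIntegral.sum_integral_adjacent_intervals (n := N) (μ := volume)
    (f := fun s => h ⌊N * s⌋₊ * w s) (a := fun k : ℕ => (k : ℝ) / N) (fun k hk => by
      refine ((hwk k hk).const_mul (h k)).congr_ae ?_
      rw [EventuallyEq, ae_restrict_iff' measurableSet_uIoc]
      exact hae k)
  simp only [Nat.cast_zero, zero_div, div_self hN'.ne'] at hsum
  rw [← hsum]
  refine Finset.sum_congr rfl fun k _ => ?_
  rw [← intervalIntegral.integral_const_mul]
  exact (intervalIntegral.integral_congr_ae (hae k)).symm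

/-- Abel summation, used to trade path values for independent increments. -/
theorem sum_mul_sub_eq_sum_sub_mul (x g : ℕ → ℝ) (n : ℕ) :
    ∑ k ∈ Finset.range n, x (k + 1) * (g k - g (k + 1)) =
      ∑ k ∈ Finset.range n, (x (k + 1) - x k) * g k - x n * g n + x 0 * g 0 := by
  induction n with
  | zero => simp
  | succ n ih => rw [Finset.sum_range_succ, Finset.sum_range_succ, ih]; ring

theorem tendsto_floor_div {s : ℝ} (hs : 0 ≤ s) :
    Tendsto (fun m : ℕ => (⌊((m + 1 : ℕ) : ℝ) * s⌋₊ : ℝ) / ((m + 1 : ℕ) : ℝ)) atTop (𝓝 s) := by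
  have h := (tendsto_nat_floor_mul_div_atTop hs).comp
    (tendsto_natCast_atTop_atTop.comp (tendsto_add_atTop_nat 1))
  simpa [Function.comp_def, mul_comm] using h

theorem tendsto_floor_add_one_div {s : ℝ} (hs : 0 ≤ s) :
    Tendsto (fun m : ℕ => ((⌊((m + 1 : ℕ) : ℝ) * s⌋₊ : ℝ) + 1) / ((m + 1 : ℕ) : ℝ))
      atTop (𝓝 s) := by
  have h := (tendsto_floor_div hs).add (tendsto_one_div_add_atTop_nhds_zero_nat (𝕜 := ℝ))
  simpa [add_div] using h

/-- Left Riemann sums of a continuous function on the unit interval converge. -/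
theorem tendsto_riemann_sum {f : ℝ → ℝ} (hf : ContinuousOn f (Icc 0 1)) :
    Tendsto (fun m : ℕ => ∑ k ∈ Finset.range (m + 1),
      f ((k : ℝ) / ((m + 1 : ℕ) : ℝ)) * (1 / ((m + 1 : ℕ) : ℝ))) atTop
      (𝓝 (∫ s in (0 : ℝ)..1, f s)) := by
  obtain ⟨C, hC⟩ := isCompact_Icc.exists_bound_of_continuousOn hf
  have hfloor : ∀ m : ℕ, ∀ s ∈ Ioc (0 : ℝ) 1,
      (⌊((m + 1 : ℕ) : ℝ) * s⌋₊ : ℝ) / ((m + 1 : ℕ) : ℝ) ∈ Icc (0 : ℝ) 1 := fun m s hs => by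
    refine ⟨by positivity, ?_⟩
    rw [div_le_iff₀ (by positivity)]
    refine (Nat.floor_le (mul_nonneg (Nat.cast_nonneg _) hs.1.le)).trans ?_
    nlinarith [hs.2, Nat.cast_nonneg (α := ℝ) (m + 1)]
  have heq : ∀ m : ℕ, ∑ k ∈ Finset.range (m + 1),
      f ((k : ℝ) / ((m + 1 : ℕ) : ℝ)) * (1 / ((m + 1 : ℕ) : ℝ)) =
      ∫ s in (0 : ℝ)..1, f ((⌊((m + 1 : ℕ) : ℝ) * s⌋₊ : ℝ) / ((m + 1 : ℕ) : ℝ)) := fun m => by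
    have h := integral_floor_mul (N := m + 1) m.succ_pos
      (fun k => f ((k : ℝ) / ((m + 1 : ℕ) : ℝ))) (w := fun _ => 1) intervalIntegrable_const
    simp only [mul_one] at h
    rw [h]
    refine Finset.sum_congr rfl fun k _ => ?_
    rw [intervalIntegral.integral_const]
    push_cast
    simp only [smul_eq_mul, mul_one]
    ring
  simp_rw [heq]
  refine intervalIntegral.tendsto_integral_filter_of_dominated_convergence (fun _ => C) ?_ ?_
    intervalIntegrable_const ?_
  · refine Eventually.of_forall fun m => Measurable.aestronglyMeasurable ?_
    exact (Measurable.of_discrete (f := fun k : ℕ => f ((k : ℝ) / ((m + 1 : ℕ) : ℝ)))).comp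
      (Nat.measurable_floor.comp (measurable_const_mul _))
  · refine Eventually.of_forall fun m => Eventually.of_forall fun s hs => ?_
    rw [uIoc_of_le zero_le_one] at hs
    exact hC _ (hfloor m s hs)
  · refine Eventually.of_forall fun s hs => ?_
    rw [uIoc_of_le zero_le_one] at hs
    have h1 : Tendsto (fun m : ℕ => (⌊((m + 1 : ℕ) : ℝ) * s⌋₊ : ℝ) / ((m + 1 : ℕ) : ℝ)) atTop
        (𝓝[Icc 0 1] s) :=
      tendsto_nhdsWithin_of_tendsto_nhds_of_eventually_within _ (tendsto_floor_div hs.1.le)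
        (Eventually.of_forall fun m => hfloor m s hs)
    exact (hf s ⟨hs.1.le, hs.2⟩).tendsto.comp h1

end RiemannSums

/-! ### Laplace transform of a weighted path average. -/

section WeightedAverage

variable {Ω : Type u} [MeasurableSpace Ω] {P : Measure Ω} [IsProbabilityMeasure P]
  {X : ℝ≥0 → Ω → ℝ}

namespace IsLevySubordinator

/-- Independence factorizes the transform. Nonnegative `g k` keep `θ * g k ≤ 0`, where the exponent
is known to be linear in time. -/
theorem mgf_sum_increments (hX : IsLevySubordinator X P) (d : ℝ≥0) {θ : ℝ} (hθ : θ ≤ 0)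
    {g : ℕ → ℝ} (N : ℕ) (hg : ∀ k < N, 0 ≤ g k) :
    mgf (fun ω => ∑ k ∈ Finset.range N, (X ((k + 1 : ℕ) * d) ω - X (k * d) ω) * g k) P θ =
      Real.exp (∑ k ∈ Finset.range N, (d : ℝ) * cgf (X 1) P (θ * g k)) := by
  have hmono : Monotone fun k : ℕ => (k : ℝ≥0) * d := fun a b hab => by
    simp only; gcongr
  have hind := (hX.indep.nat hmono).comp (fun k x => x * g k)
    (fun k => measurable_id.mul_const (g k))
  have hmeas : ∀ k : ℕ, Measurable ((fun x => x * g k) ∘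
      fun ω => X ((k + 1 : ℕ) * d) ω - X (k * d) ω) := fun k =>
    (measurable_id.mul_const (g k)).comp ((hX.measurable _).sub (hX.measurable _))
  have hsum := hind.mgf_sum (t := θ) hmeas (Finset.range N)
  rw [Real.exp_sum]
  convert! hsum using 1
  · congr 1
    ext ω
    simp
  · refine Finset.prod_congr rfl fun k hk => ?_
    have hgk := hg k (Finset.mem_range.1 hk)
    rw [← hX.mgf_eq_exp (mul_nonpos_of_nonpos_of_nonneg hθ hgk),
      ← mgf_congr_of_identDistrib _ _ (hX.stationary (k * d) d)]
    simp only [mgf, Function.comp]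
    congr 1
    ext ω
    push_cast
    rw [add_mul, one_mul]
    congr 1
    ring

/-- Sampling at the right end of each cell makes the sample times approach `t s` from the right, so
right continuity suffices; monotonicity supplies the dominating function. -/
theorem tendsto_stepAverage {t : ℝ≥0} {x : ℝ≥0 → ℝ} (h0 : 0 ≤ x 0) (hm : Monotone x)
    (hr : ∀ s : ℝ≥0, ContinuousWithinAt x (Ici s) s) {w : ℝ → ℝ}
    (hw : IntervalIntegrable w volume 0 1) :
    Tendsto (fun m : ℕ => ∫ s in (0 : ℝ)..1,
        x ((⌊((m + 1 : ℕ) : ℝ) * s⌋₊ + 1 : ℕ) * (t / (m + 1 : ℕ))) * w s) atTop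
      (𝓝 (∫ s in (0 : ℝ)..1, x (t * s.toNNReal) * w s)) := by
  -- At `s = 1` the sample index is `m + 2`, past the last cell, and the bound by `x t` could fail.
  have hlt : ∀ᵐ s : ℝ, s ≠ 1 := compl_mem_ae_iff.2 (measure_singleton 1)
  refine intervalIntegral.tendsto_integral_filter_of_dominated_convergence
    (fun s => x t * |w s|) ?_ ?_ (hw.abs.const_mul _) ?_
  · refine Eventually.of_forall fun m => AEStronglyMeasurable.mul
      (Measurable.aestronglyMeasurable ?_) hw.def'.aestronglyMeasurable
    exact (Measurable.of_discrete (f := fun k : ℕ => x ((k + 1 : ℕ) * (t / (m + 1 : ℕ))))).comp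
      (Nat.measurable_floor.comp (measurable_const_mul _))
  · refine Eventually.of_forall fun m => ?_
    filter_upwards [hlt] with s hs1 hs
    rw [uIoc_of_le zero_le_one] at hs
    rw [norm_mul, Real.norm_eq_abs, Real.norm_eq_abs, abs_of_nonneg (h0.trans (hm zero_le))]
    refine mul_le_mul_of_nonneg_right (hm ?_) (abs_nonneg _)
    have hfl : ⌊((m + 1 : ℕ) : ℝ) * s⌋₊ < m + 1 := by
      rw [Nat.floor_lt (mul_nonneg (Nat.cast_nonneg _) hs.1.le)]
      have : s < 1 := lt_of_le_of_ne hs.2 hs1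
      have h2 : (0 : ℝ) < ((m + 1 : ℕ) : ℝ) := by positivity
      nlinarith
    calc ((⌊((m + 1 : ℕ) : ℝ) * s⌋₊ + 1 : ℕ) : ℝ≥0) * (t / (m + 1 : ℕ))
        ≤ ((m + 1 : ℕ) : ℝ≥0) * (t / (m + 1 : ℕ)) := by
          gcongr
          exact Nat.lt_succ_iff.1 hfl
      _ = t := mul_div_cancel₀ _ (by positivity)
  · refine Eventually.of_forall fun s hs => ?_
    rw [uIoc_of_le zero_le_one] at hs
    refine Tendsto.mul_const _ ((hr (t * s.toNNReal)).tendsto.comp ?_)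
    refine tendsto_nhdsWithin_of_tendsto_nhds_of_eventually_within _ ?_ ?_
    · rw [← NNReal.tendsto_coe]
      have h := (tendsto_floor_add_one_div hs.1.le).const_mul (t : ℝ)
      convert! h using 2
      · push_cast
        ring
      · simp [hs.1.le]
    · refine Eventually.of_forall fun m => ?_
      rw [mem_Ici, ← NNReal.coe_le_coe]
      push_cast
      rw [Real.coe_toNNReal _ hs.1.le]
      have h1 := (Nat.lt_floor_add_one (((m : ℝ) + 1) * s)).le
      have h2 : (0 : ℝ) < (m : ℝ) + 1 := by positivity
      calc (t : ℝ) * s = ((m : ℝ) + 1) * s * (t / (m + 1)) := by field_simp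
        _ ≤ _ := by gcongr

/-- The Laplace transform of a weighted average of the paths of a subordinator. -/
theorem mgf_weightedAverage (hX : IsLevySubordinator X P)
    (hint : 0 ∈ interior (integrableExpSet (X 1) P)) {t : ℝ≥0} {w : ℝ → ℝ}
    (hw : IntervalIntegrable w volume 0 1) (hw0 : ∀ s ∈ Ioo (0 : ℝ) 1, 0 ≤ w s) {A : Ω → ℝ}
    (hA : ∀ᵐ ω ∂P, A ω = ∫ s in (0 : ℝ)..1, X (t * s.toNNReal) ω * w s) :
    AEMeasurable A P ∧ (∀ᵐ ω ∂P, 0 ≤ A ω) ∧ ∀ x : ℝ, 0 ≤ x →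
      mgf A P (-x) =
        Real.exp (t * ∫ s in (0 : ℝ)..1, cgf (X 1) P (-((∫ y in s..1, w y) * x))) := by
  -- The increment of the path at time `t s` is counted with the weight of all later times, `G s`.
  set G : ℝ → ℝ := fun s => ∫ y in s..1, w y with hG
  have hwsub : ∀ a ∈ Icc (0 : ℝ) 1, ∀ b ∈ Icc (0 : ℝ) 1, IntervalIntegrable w volume a b :=
    fun a ha b hb => hw.mono_set (by
      rw [uIcc_of_le zero_le_one]
      exact ordConnected_Icc.uIcc_subset ha hb)
  have hwnn : ∀ a b : ℝ, 0 ≤ a → a ≤ b → b ≤ 1 → 0 ≤ ∫ y in a..b, w y := fun a b ha hab hb => by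
    refine intervalIntegral.integral_nonneg_of_ae_restrict hab ?_
    have h1 : ∀ᵐ s : ℝ, s ≠ a := compl_mem_ae_iff.2 (measure_singleton a)
    have h2 : ∀ᵐ s : ℝ, s ≠ b := compl_mem_ae_iff.2 (measure_singleton b)
    rw [EventuallyLE, ae_restrict_iff' measurableSet_Icc]
    filter_upwards [h1, h2] with s hs1 hs2 hs
    exact hw0 s ⟨ha.trans_lt (lt_of_le_of_ne hs.1 (Ne.symm hs1)),
      (lt_of_le_of_ne hs.2 hs2).trans_le hb⟩
  have hG0 : ∀ s ∈ Icc (0 : ℝ) 1, 0 ≤ G s := fun s hs => hwnn s 1 hs.1 hs.2 le_rfl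
  have hGcont : ContinuousOn G (Icc 0 1) := by
    have := intervalIntegral.continuousOn_primitive_interval_left (f := w) (a := 0) (b := 1)
      (μ := volume) (by rw [uIcc_of_le zero_le_one, integrableOn_Icc_iff_integrableOn_Ioc]
                        exact (intervalIntegrable_iff_integrableOn_Ioc_of_le zero_le_one).1 hw)
    rwa [uIcc_of_le zero_le_one] at this
  -- `G` vanishes at `1`, so continuity of the exponent is wanted at `0` too; there `hint` supplies
  -- it.
  have hIic : ∀ θ : ℝ, θ ≤ 0 → θ ∈ interior (integrableExpSet (X 1) P) := fun θ hθ => by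
    rcases hθ.eq_or_lt with rfl | hθ
    · exact hint
    · exact mem_interior_iff_mem_nhds.2 (mem_of_superset (Iio_mem_nhds hθ) fun y hy =>
        hX.mem_integrableExpSet 1 (le_of_lt hy))
  -- Only the path is discretized: the exact cell integrals of `w` allow an unbounded integrable
  -- weight.
  set S : ℕ → Ω → ℝ := fun m ω => ∑ k ∈ Finset.range (m + 1),
    X ((k + 1 : ℕ) * (t / (m + 1 : ℕ))) ω *
      ∫ s in ((k : ℝ) / (m + 1 : ℕ))..(((k + 1 : ℕ) : ℝ) / (m + 1 : ℕ)), w s with hS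
  have hSmeas : ∀ m, Measurable (S m) := fun m =>
    Finset.measurable_sum _ fun k _ => (hX.measurable _).mul_const _
  have hmem : ∀ m k : ℕ, k ≤ m + 1 → (k : ℝ) / (m + 1 : ℕ) ∈ Icc (0 : ℝ) 1 := fun m k hk => by
    refine ⟨by positivity, ?_⟩
    rw [div_le_one (by positivity)]
    exact_mod_cast hk
  have hdiv : ∀ m k : ℕ, (k : ℝ) / (m + 1 : ℕ) ≤ ((k + 1 : ℕ) : ℝ) / (m + 1 : ℕ) :=
    fun m k => by gcongr; simp
  have hS0 : ∀ m, ∀ᵐ ω ∂P, 0 ≤ S m ω := fun m => by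
    filter_upwards [hX.ae_nonneg] with ω hω
    refine Finset.sum_nonneg fun k hk => mul_nonneg (hω _) ?_
    have hk' := Finset.mem_range.1 hk
    exact hwnn _ _ (hmem m k hk'.le).1 (hdiv m k) (hmem m (k + 1) hk').2
  have hlim : ∀ᵐ ω ∂P, Tendsto (fun m => S m ω) atTop (𝓝 (A ω)) := by
    filter_upwards [hA, hX.start, hX.monotone, hX.rightCts] with ω hAω h0 hm hr
    have h := tendsto_stepAverage (t := t) (x := fun s => X s ω) h0.ge hm hr hw
    rw [hAω]
    refine h.congr fun m => ?_
    exact integral_floor_mul (N := m + 1) m.succ_pos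
      (fun k => X ((k + 1 : ℕ) * (t / (m + 1 : ℕ))) ω) hw
  have hAmeas : AEMeasurable A P :=
    aemeasurable_of_tendsto_metrizable_ae atTop (fun m => (hSmeas m).aemeasurable) hlim
  have hA0 : ∀ᵐ ω ∂P, 0 ≤ A ω := by
    filter_upwards [hlim, ae_all_iff.2 hS0] with ω h1 h2
    exact ge_of_tendsto' h1 h2
  refine ⟨hAmeas, hA0, fun x hx => ?_⟩
  have hSmgf : ∀ m, mgf (S m) P (-x) = Real.exp (t * ∑ k ∈ Finset.range (m + 1),
      cgf (X 1) P (-(G ((k : ℝ) / (m + 1 : ℕ)) * x)) * (1 / (m + 1 : ℕ))) := fun m => by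
    have h1 := hX.mgf_sum_increments (t / (m + 1 : ℕ)) (θ := -x) (by linarith)
      (g := fun k => G ((k : ℝ) / (m + 1 : ℕ))) (m + 1)
      (fun k hk => hG0 _ (hmem m k hk.le))
    -- Both boundary terms of the Abel summation vanish, since `G 1 = 0` and `X 0 = 0` almost
    -- surely.
    have h2 : mgf (S m) P (-x) = mgf (fun ω => ∑ k ∈ Finset.range (m + 1),
        (X ((k + 1 : ℕ) * (t / (m + 1 : ℕ))) ω - X (k * (t / (m + 1 : ℕ))) ω) *
          G ((k : ℝ) / (m + 1 : ℕ))) P (-x) := by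
      refine mgf_congr ?_
      filter_upwards [hX.start] with ω h0
      have h3 := sum_mul_sub_eq_sum_sub_mul (fun k => X (k * (t / (m + 1 : ℕ))) ω)
        (fun k => G ((k : ℝ) / (m + 1 : ℕ))) (m + 1)
      have h4 : G (((m + 1 : ℕ) : ℝ) / (m + 1 : ℕ)) = 0 := by
        rw [div_self (by positivity)]
        simp [hG]
      simp only [h4, Nat.cast_zero, zero_mul, h0, mul_zero, sub_zero, add_zero] at h3
      rw [← h3]
      refine Finset.sum_congr rfl fun k hk => ?_
      have hk' := Finset.mem_range.1 hk
      congr 1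
      have := intervalIntegral.integral_add_adjacent_intervals
        (hwsub _ (hmem m k hk'.le) _ (hmem m (k + 1) hk'))
        (hwsub _ (hmem m (k + 1) hk') 1 ⟨zero_le_one, le_rfl⟩)
      simp only [hG]
      linarith
    rw [h2, h1, Finset.mul_sum]
    congr 1
    refine Finset.sum_congr rfl fun k _ => ?_
    push_cast
    rw [neg_mul, mul_comm x]
    ring
  have hψ : ContinuousOn (fun s => cgf (X 1) P (-(G s * x))) (Icc 0 1) := by
    have h1 : ContinuousOn (cgf (X 1) P) (interior (integrableExpSet (X 1) P)) :=
      analyticOn_cgf.continuousOn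
    refine h1.comp (hGcont.mul continuousOn_const).neg fun s hs => hIic _ ?_
    have := mul_nonneg (hG0 s hs) hx
    simpa using this
  have hR : Tendsto (fun m => mgf (S m) P (-x)) atTop
      (𝓝 (Real.exp (t * ∫ s in (0 : ℝ)..1, cgf (X 1) P (-(G s * x))))) := by
    simp_rw [hSmgf]
    exact (Real.continuous_exp.tendsto _).comp ((tendsto_riemann_sum hψ).const_mul _)
  -- The second limit of the same sequence: the integrands are at most `1` because `S m ≥ 0` and `-x
  -- ≤ 0`.
  have hL : Tendsto (fun m => mgf (S m) P (-x)) atTop (𝓝 (mgf A P (-x))) := by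
    refine tendsto_integral_of_dominated_convergence (fun _ => 1)
      (fun m => ((hSmeas m).const_mul _).exp.aestronglyMeasurable) (integrable_const _)
      (fun m => ?_) ?_
    · filter_upwards [hS0 m] with ω hω
      rw [Real.norm_eq_abs, Real.abs_exp, Real.exp_le_one_iff]
      nlinarith
    · filter_upwards [hlim] with ω hω
      exact (Real.continuous_exp.tendsto _).comp (hω.const_mul _)
  exact tendsto_nhds_unique hL hR

end IsLevySubordinator

end WeightedAverage

/-! ### Kernels and their moments, through the substitution `s = e^{-u}`. -/

section Kernels

theorem exp_neg_image_Ioi : (fun u : ℝ => Real.exp (-u)) '' Ioi 0 = Ioo 0 1 := by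
  ext s
  simp only [mem_image, mem_Ioi, mem_Ioo]
  constructor
  · rintro ⟨u, hu, rfl⟩
    exact ⟨Real.exp_pos _, by simpa using hu⟩
  · rintro ⟨h0, h1⟩
    exact ⟨-Real.log s, by simpa using Real.log_neg h0 h1, by simp [Real.exp_log h0]⟩

theorem exp_neg_image_Ioo {s : ℝ} (hs : 0 < s) :
    (fun u : ℝ => Real.exp (-u)) '' Ioo 0 (-Real.log s) = Ioo s 1 := by
  ext y
  simp only [mem_image, mem_Ioo]
  constructor
  · rintro ⟨u, ⟨hu, hu'⟩, rfl⟩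
    refine ⟨?_, by simpa using hu⟩
    rw [← Real.log_lt_iff_lt_exp hs]
    linarith
  · rintro ⟨h0, h1⟩
    have hy := hs.trans h0
    exact ⟨-Real.log y, ⟨by simpa using Real.log_neg hy h1, by simpa using Real.log_lt_log hs h0⟩,
      by simp [Real.exp_log hy]⟩

theorem hasDerivWithinAt_exp_neg (A : Set ℝ) (u : ℝ) :
    HasDerivWithinAt (fun u : ℝ => Real.exp (-u)) (-Real.exp (-u)) A u := by
  simpa using ((hasDerivAt_neg u).exp).hasDerivWithinAt

theorem injOn_exp_neg (A : Set ℝ) : InjOn (fun u : ℝ => Real.exp (-u)) A := fun a _ b _ h => by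
  simpa using h

theorem intervalIntegrable_neg_log_rpow {n : ℝ} (hn : 0 < n) :
    IntervalIntegrable (fun s => (-Real.log s) ^ (n - 1)) volume 0 1 := by
  rw [intervalIntegrable_iff_integrableOn_Ioo_of_le zero_le_one, ← exp_neg_image_Ioi,
    integrableOn_image_iff_integrableOn_abs_deriv_smul measurableSet_Ioi
      (fun u _ => hasDerivWithinAt_exp_neg _ u) (injOn_exp_neg _)]
  refine (Real.GammaIntegral_convergent hn).congr_fun (fun u _ => ?_) measurableSet_Ioi
  simp

/-- A Gamma integral of rate `m + 1` after the substitution. It yields the type II coefficients; `m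
= 0` gives the total mass of the type I weight. -/
theorem integral_neg_log_rpow_mul_pow {n : ℝ} (hn : 0 < n) (m : ℕ) :
    ∫ s in (0 : ℝ)..1, (-Real.log s) ^ (n - 1) * s ^ m = Real.Gamma n / ((m : ℝ) + 1) ^ n := by
  have hm : (0 : ℝ) < (m : ℝ) + 1 := by positivity
  rw [intervalIntegral.integral_of_le zero_le_one, integral_Ioc_eq_integral_Ioo,
    ← exp_neg_image_Ioi, integral_image_eq_integral_abs_deriv_smul measurableSet_Ioi
      (fun u _ => hasDerivWithinAt_exp_neg _ u) (injOn_exp_neg _)]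
  have h := Real.integral_rpow_mul_exp_neg_mul_Ioi hn hm
  rw [one_div, Real.inv_rpow hm.le] at h
  rw [div_eq_inv_mul, ← h]
  refine setIntegral_congr_fun measurableSet_Ioi fun u _ => ?_
  simp only [abs_neg, Real.abs_exp, Real.log_exp, neg_neg, smul_eq_mul]
  rw [← Real.exp_nat_mul, mul_left_comm, ← Real.exp_add]
  congr 2
  ring

/-- The substitution leaves a lower incomplete Gamma integral, so `kernelI n` is the tail weight `G`
of the normalized logarithmic average. -/
theorem integral_neg_log_rpow_eq {n : ℝ} (hn : 0 < n) {s : ℝ} (hs : s ∈ Ioc (0 : ℝ) 1) :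
    ∫ y in s..1, (-Real.log y) ^ (n - 1) = Real.Gamma n * kernelI n s := by
  have hL : 0 ≤ -Real.log s := by simpa using Real.log_nonpos hs.1.le hs.2
  rw [intervalIntegral.integral_of_le hs.2, integral_Ioc_eq_integral_Ioo,
    ← exp_neg_image_Ioo hs.1, integral_image_eq_integral_abs_deriv_smul measurableSet_Ioo
      (fun u _ => hasDerivWithinAt_exp_neg _ u) (injOn_exp_neg _)]
  have hint : IntegrableOn (fun y : ℝ => y ^ (n - 1) * Real.exp (-y)) (Ioi 0) := by
    refine (Real.GammaIntegral_convergent hn).congr_fun (fun u _ => ?_) measurableSet_Ioi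
    simp only
    ring
  have hsplit : ∫ y in Ioi (0 : ℝ), y ^ (n - 1) * Real.exp (-y) =
      (∫ y in Ioc 0 (-Real.log s), y ^ (n - 1) * Real.exp (-y)) +
        upperGamma n (-Real.log s) := by
    rw [upperGamma, ← setIntegral_union (Ioc_disjoint_Ioi le_rfl) measurableSet_Ioi
      (hint.mono_set Ioc_subset_Ioi_self) (hint.mono_set (Ioi_subset_Ioi hL)),
      Ioc_union_Ioi_eq_Ioi hL]
  have hG : Real.Gamma n = ∫ y in Ioi (0 : ℝ), y ^ (n - 1) * Real.exp (-y) := by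
    rw [Real.Gamma_eq_integral hn]
    simp_rw [mul_comm]
  have hG0 : Real.Gamma n ≠ 0 := (Real.Gamma_pos_of_pos hn).ne'
  have hR : Real.Gamma n * kernelI n s = Real.Gamma n - upperGamma n (-Real.log s) := by
    rw [kernelI]
    field_simp
  rw [hR, hG, hsplit, add_sub_cancel_right, integral_Ioc_eq_integral_Ioo]
  refine setIntegral_congr_fun measurableSet_Ioo fun u _ => ?_
  simp [mul_comm]

theorem kernelI_eq_integral {n : ℝ} (hn : 0 < n) {s : ℝ} (hs : s ∈ Ioc (0 : ℝ) 1) :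
    kernelI n s = ∫ y in s..1, (-Real.log y) ^ (n - 1) / Real.Gamma n := by
  rw [intervalIntegral.integral_div, integral_neg_log_rpow_eq hn hs,
    mul_div_cancel_left₀ _ (Real.Gamma_pos_of_pos hn).ne']

theorem abs_kernelI_le_one {n : ℝ} (hn : 0 < n) {s : ℝ} (hs : s ∈ Ioc (0 : ℝ) 1) :
    |kernelI n s| ≤ 1 := by
  have hG := Real.Gamma_pos_of_pos hn
  have hw := intervalIntegrable_neg_log_rpow hn
  have hnn : ∀ y ∈ Icc (0 : ℝ) 1, 0 ≤ (-Real.log y) ^ (n - 1) := fun y hy =>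
    Real.rpow_nonneg (by simpa using Real.log_nonpos hy.1 hy.2) _
  have h0 : ∫ y in (0 : ℝ)..1, (-Real.log y) ^ (n - 1) = Real.Gamma n := by
    simpa using integral_neg_log_rpow_mul_pow hn 0
  have hk := integral_neg_log_rpow_eq hn hs
  have hs1 : 0 ≤ ∫ y in s..1, (-Real.log y) ^ (n - 1) :=
    intervalIntegral.integral_nonneg hs.2 fun y hy => hnn y ⟨hs.1.le.trans hy.1, hy.2⟩
  have hs2 : 0 ≤ ∫ y in (0 : ℝ)..s, (-Real.log y) ^ (n - 1) :=
    intervalIntegral.integral_nonneg hs.1.le fun y hy => hnn y ⟨hy.1, hy.2.trans hs.2⟩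
  have hmem : s ∈ uIcc (0 : ℝ) 1 := by
    rw [uIcc_of_le zero_le_one]; exact ⟨hs.1.le, hs.2⟩
  have hadd := intervalIntegral.integral_add_adjacent_intervals
    (hw.mono_set (uIcc_subset_uIcc left_mem_uIcc hmem))
    (hw.mono_set (uIcc_subset_uIcc hmem right_mem_uIcc))
  rw [abs_le]
  constructor <;> nlinarith

theorem aestronglyMeasurable_kernelI {n : ℝ} (hn : 0 < n) :
    AEStronglyMeasurable (kernelI n) (volume.restrict (Ioc 0 1)) := by
  have hw := (intervalIntegrable_neg_log_rpow hn).div_const (Real.Gamma n)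
  have hc := intervalIntegral.continuousOn_primitive_interval_left
    (f := fun y => (-Real.log y) ^ (n - 1) / Real.Gamma n) (a := 0) (b := 1) (μ := volume)
    (by rw [uIcc_of_le zero_le_one, integrableOn_Icc_iff_integrableOn_Ioc]
        exact (intervalIntegrable_iff_integrableOn_Ioc_of_le zero_le_one).1 hw)
  rw [uIcc_of_le zero_le_one] at hc
  refine ((hc.mono Ioc_subset_Icc_self).aestronglyMeasurable measurableSet_Ioc).congr ?_
  refine (ae_restrict_iff' measurableSet_Ioc).2 (Eventually.of_forall fun s hs => ?_)
  exact (kernelI_eq_integral hn hs).symm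

theorem integral_rpow_div_pow {n : ℝ} (hn : 0 < n) (m : ℕ) :
    ∫ s in (0 : ℝ)..1, (s ^ n / Real.Gamma (n + 1)) ^ m = coeffIII n m := by
  have hmn : 0 ≤ n * m := by positivity
  have h : ∀ s ∈ uIcc (0 : ℝ) 1, (s ^ n / Real.Gamma (n + 1)) ^ m =
      s ^ (n * m) / Real.Gamma (n + 1) ^ m := fun s hs => by
    rw [uIcc_of_le zero_le_one] at hs
    rw [div_pow, Real.rpow_mul hs.1, Real.rpow_natCast]
  rw [intervalIntegral.integral_congr h, intervalIntegral.integral_div,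
    integral_rpow (Or.inl (by linarith)), Real.one_rpow, Real.zero_rpow (by positivity), coeffIII]
  have : Real.Gamma (n + 1) ≠ 0 := (Real.Gamma_pos_of_pos (by linarith)).ne'
  field_simp
  ring

theorem integral_one_sub_rpow {n : ℝ} (hn : 0 < n) (s : ℝ) :
    ∫ y in s..1, (1 - y) ^ (n - 1) / Real.Gamma n = (1 - s) ^ n / Real.Gamma (n + 1) := by
  rw [intervalIntegral.integral_div,
    intervalIntegral.integral_comp_sub_left (fun y => y ^ (n - 1)) 1, sub_self,
    integral_rpow (Or.inl (by linarith)), sub_add_cancel, Real.zero_rpow hn.ne', sub_zero,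
    Real.Gamma_add_one hn.ne', div_div]

end Kernels

/-! ### Rescaling the fractional averages to the unit interval. -/

section FractionalAverages

theorem integral_eq_mul_integral_unit (t : ℝ) (f : ℝ → ℝ) :
    ∫ s in (0 : ℝ)..t, f s = t * ∫ s in (0 : ℝ)..1, f (t * s) := by
  simp

theorem fracAverageI_eq_integral {Ω : Type u} (X : ℝ≥0 → Ω → ℝ) (n : ℝ) {t : ℝ≥0} (ht : 0 < t) (ω : Ω) :
    fracAverageI X n t ω = ∫ s in (0 : ℝ)..1,
      X (t * s.toNNReal) ω * ((-Real.log s) ^ (n - 1) / Real.Gamma n) := by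
  have ht' : (t : ℝ) ≠ 0 := by exact_mod_cast ht.ne'
  have h : ∀ s : ℝ, X (t * s.toNNReal) ω * ((-Real.log s) ^ (n - 1) / Real.Gamma n) =
      (Real.Gamma n)⁻¹ * (X ((t : ℝ) * s).toNNReal ω *
        Real.log ((t : ℝ) / (t * s)) ^ (n - 1)) := fun s => by
    rw [Real.toNNReal_mul t.coe_nonneg, Real.toNNReal_coe, div_mul_cancel_left₀ ht', Real.log_inv]
    ring
  simp_rw [h]
  rw [intervalIntegral.integral_const_mul, fracAverageI, integral_eq_mul_integral_unit]
  field_simp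

theorem fracAverageIII_eq_integral {Ω : Type u} (X : ℝ≥0 → Ω → ℝ) (n : ℝ) {t : ℝ≥0} (ht : 0 < t) (ω : Ω) :
    fracAverageIII X n t ω = ∫ s in (0 : ℝ)..1,
      X (t * s.toNNReal) ω * ((1 - s) ^ (n - 1) / Real.Gamma n) := by
  have ht' : (0 : ℝ) < t := by exact_mod_cast ht
  have h : ∀ s ∈ uIcc (0 : ℝ) 1, X (t * s.toNNReal) ω * ((1 - s) ^ (n - 1) / Real.Gamma n) =
      ((t : ℝ) ^ (n - 1) * Real.Gamma n)⁻¹ * (((t : ℝ) - t * s) ^ (n - 1) *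
        X ((t : ℝ) * s).toNNReal ω) := fun s hs => by
    rw [uIcc_of_le zero_le_one] at hs
    have h1 : (t : ℝ) - t * s = t * (1 - s) := by ring
    have h2 : (t : ℝ) ^ (n - 1) ≠ 0 := (Real.rpow_pos_of_pos ht' _).ne'
    rw [Real.toNNReal_mul t.coe_nonneg, Real.toNNReal_coe, h1,
      Real.mul_rpow ht'.le (by linarith [hs.2])]
    field_simp
  rw [intervalIntegral.integral_congr h, intervalIntegral.integral_const_mul, fracAverageIII,
    integral_eq_mul_integral_unit, Real.rpow_sub_one ht'.ne']
  field_simp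

end FractionalAverages

/-! ### From laws to cumulants. -/

section Laws

variable {Ω : Type u} [MeasurableSpace Ω] {P : Measure Ω} [IsProbabilityMeasure P]
  {X : ℝ≥0 → Ω → ℝ} {Ω' : Type v} [MeasurableSpace Ω'] {P' : Measure Ω'}
  [IsProbabilityMeasure P'] {W : Ω' → ℝ}

/-- The degenerate mixture, with a single dilation factor `1`. -/
theorem IsLevySubordinator.hasCumulantExpansion_and_cumulant (hX : IsLevySubordinator X P)
    (hint : 0 ∈ interior (integrableExpSet (X 1) P)) (t : ℝ≥0) :
    HasCumulantExpansion (X t) P ∧ ∀ m, cumulant (X t) P m = t * cumulant (X 1) P m := by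
  have h := cumulant_of_mgf_eq_mixture (W := X t) (P := P) hint (μ := Measure.dirac (0 : ℝ))
    (k := fun _ => 1) (g := fun _ => 1) (M := 1) (c := t) (integrable_const _)
    aestronglyMeasurable_const (by simp) (hX.measurable t).aemeasurable
    (hX.ae_nonneg.mono fun _ h => h t) (fun x hx => by
      simpa using hX.mgf_eq_exp (neg_nonpos.2 hx) t)
  simpa using h

/-- The three types differ only in the constant `a`, the weight `k` and the dilation `g`. The factor
`t` is absorbed in passing from `X 1` to `X t`. -/
theorem hasScaledCumulants_of_mgf_eq (hX : IsLevySubordinator X P)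
    (hint : 0 ∈ interior (integrableExpSet (X 1) P)) {t : ℝ≥0} {a : ℝ} {k g : ℝ → ℝ} {M : ℝ}
    (hk : IntervalIntegrable k volume 0 1)
    (hg : AEStronglyMeasurable g (volume.restrict (Ioc 0 1))) (hM : ∀ s ∈ Ioc (0 : ℝ) 1, |g s| ≤ M)
    (hW : AEMeasurable W P') (hW0 : ∀ᵐ ω ∂P', 0 ≤ W ω)
    (h : ∀ x : ℝ, 0 ≤ x → mgf W P' (-x) =
      Real.exp (t * a * ∫ s in (0 : ℝ)..1, k s * cgf (X 1) P (-x * g s)))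
    {c : ℕ → ℝ} (hc : ∀ m, a * ∫ s in (0 : ℝ)..1, k s * g s ^ m = c m) :
    HasScaledCumulants W P' (X t) P c := by
  simp only [intervalIntegral.integral_of_le zero_le_one] at h hc
  obtain ⟨h1, h2⟩ := cumulant_of_mgf_eq_mixture hint
    ((intervalIntegrable_iff_integrableOn_Ioc_of_le zero_le_one).1 hk) hg
    ((ae_restrict_iff' measurableSet_Ioc).2 (Eventually.of_forall hM)) hW hW0 h
  refine ⟨h1, fun m _ => ?_⟩
  rw [h2, (hX.hasCumulantExpansion_and_cumulant hint t).2, ← hc]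
  ring

theorem HasLawI.hasScaledCumulants (hX : IsLevySubordinator X P)
    (hint : 0 ∈ interior (integrableExpSet (X 1) P)) {n : ℝ} (hn : 0 < n) {t : ℝ≥0}
    (h : HasLawI W P' X P n t) : HasScaledCumulants W P' (X t) P (coeffI n) := by
  refine hasScaledCumulants_of_mgf_eq hX hint (a := 1) (k := fun _ => 1) (g := kernelI n) (M := 1)
    intervalIntegrable_const (aestronglyMeasurable_kernelI hn)
    (fun s hs => abs_kernelI_le_one hn hs) h.aemeasurable h.nonneg (fun x hx => ?_) fun m => ?_
  · rw [h.laplace_eq x hx]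
    simp [mul_comm x]
  · simp [coeffI]

theorem HasLawII.hasScaledCumulants (hX : IsLevySubordinator X P)
    (hint : 0 ∈ interior (integrableExpSet (X 1) P)) {n : ℝ} (hn : 0 < n) {t : ℝ≥0}
    (h : HasLawII W P' X P n t) : HasScaledCumulants W P' (X t) P (coeffII n) := by
  have hG := (Real.Gamma_pos_of_pos hn).ne'
  refine hasScaledCumulants_of_mgf_eq hX hint (a := (Real.Gamma n)⁻¹)
    (k := fun s => (-Real.log s) ^ (n - 1)) (g := fun s => s) (M := 1)
    (intervalIntegrable_neg_log_rpow hn) measurable_id.aestronglyMeasurable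
    (fun s hs => abs_le.2 ⟨by linarith [hs.1], hs.2⟩) h.aemeasurable h.nonneg
    (fun x hx => ?_) fun m => ?_
  · rw [h.laplace_eq x hx]
    simp [div_eq_mul_inv]
  · rw [integral_neg_log_rpow_mul_pow hn, coeffII]
    field_simp

theorem HasLawIII.hasScaledCumulants (hX : IsLevySubordinator X P)
    (hint : 0 ∈ interior (integrableExpSet (X 1) P)) {n : ℝ} (hn : 0 < n) {t : ℝ≥0}
    (h : HasLawIII W P' X P n t) : HasScaledCumulants W P' (X t) P (coeffIII n) := by
  have hG := Real.Gamma_pos_of_pos (by linarith : 0 < n + 1)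
  refine hasScaledCumulants_of_mgf_eq hX hint (a := 1)
    (k := fun _ => 1) (g := fun s => s ^ n / Real.Gamma (n + 1)) (M := 1 / Real.Gamma (n + 1))
    intervalIntegrable_const (by fun_prop) (fun s hs => ?_) h.aemeasurable h.nonneg
    (fun x hx => ?_) fun m => ?_
  · rw [abs_of_nonneg (div_nonneg (Real.rpow_nonneg hs.1.le _) hG.le)]
    gcongr
    exact Real.rpow_le_one hs.1.le hs.2 hn.le
  · rw [h.laplace_eq x hx]
    congr 2
    · ring
    · refine intervalIntegral.integral_congr fun s _ => ?_
      simp only [one_mul]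
      congr 1
      ring
  · simp [integral_rpow_div_pow hn]

theorem hasLawI_fracAverageI (hX : IsLevySubordinator X P)
    (hint : 0 ∈ interior (integrableExpSet (X 1) P)) {n : ℝ} (hn : 0 < n) {t : ℝ≥0} (ht : 0 < t) :
    HasLawI (fracAverageI X n t) P X P n t := by
  obtain ⟨h1, h2, h3⟩ := hX.mgf_weightedAverage hint
    ((intervalIntegrable_neg_log_rpow hn).div_const (Real.Gamma n))
    (fun s hs => div_nonneg (Real.rpow_nonneg (by simpa using Real.log_nonpos hs.1.le hs.2.le) _)
      (Real.Gamma_pos_of_pos hn).le)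
    (Eventually.of_forall fun ω => fracAverageI_eq_integral X n ht ω)
  refine ⟨h1, h2, fun x hx => ?_⟩
  rw [h3 x hx]
  congr 2
  refine intervalIntegral.integral_congr_ae (Eventually.of_forall fun s hs => ?_)
  rw [uIoc_of_le zero_le_one] at hs
  rw [kernelI_eq_integral hn hs]

theorem hasLawIII_fracAverageIII (hX : IsLevySubordinator X P)
    (hint : 0 ∈ interior (integrableExpSet (X 1) P)) {n : ℝ} (hn : 0 < n) {t : ℝ≥0} (ht : 0 < t) :
    HasLawIII (fracAverageIII X n t) P X P n t := by
  have hw : IntervalIntegrable (fun s : ℝ => (1 - s) ^ (n - 1)) volume 0 1 := by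
    have := (intervalIntegral.intervalIntegrable_rpow' (a := 0) (b := 1)
      (by linarith : -1 < n - 1)).comp_sub_left 1
    simpa using this.symm
  obtain ⟨h1, h2, h3⟩ := hX.mgf_weightedAverage hint (hw.div_const (Real.Gamma n))
    (fun s hs => div_nonneg (Real.rpow_nonneg (by linarith [hs.2]) _)
      (Real.Gamma_pos_of_pos hn).le)
    (Eventually.of_forall fun ω => fracAverageIII_eq_integral X n ht ω)
  refine ⟨h1, h2, fun x hx => ?_⟩
  rw [h3 x hx]
  congr 2
  -- The tail weight is a power of `1 - s`, the prescribed law has a power of `s`; reflection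
  -- matches them.
  have h := intervalIntegral.integral_comp_sub_left (a := 0) (b := 1)
    (fun s : ℝ => cgf (X 1) P (-(s ^ n * x / Real.Gamma (n + 1)))) 1
  simp only [sub_self, sub_zero] at h
  rw [← h]
  refine intervalIntegral.integral_congr fun s _ => ?_
  simp only [integral_one_sub_rpow hn s]
  congr 1
  ring

end Laws

/-! ### Iterated averages as single integrals. -/

section IteratedAverages

/-- Fubini's theorem on the triangle `0 < r ≤ s ≤ t` for a kernel and a bounded function. -/
theorem integral_triangle_swap {t : ℝ} (ht : 0 ≤ t) {f : ℝ → ℝ} (hf : Measurable f) {M : ℝ}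
    (hM : ∀ r ∈ Ioc 0 t, |f r| ≤ M) {k : ℝ → ℝ → ℝ} (hk : Measurable (Function.uncurry k))
    (hk0 : ∀ s r, 0 < r → r ≤ s → 0 ≤ k s r) {K : ℝ → ℝ}
    (hki : ∀ r ∈ Ioc 0 t, IntervalIntegrable (fun s => k s r) volume r t)
    (hkK : ∀ r ∈ Ioc 0 t, ∫ s in r..t, k s r = K r) (hK : IntervalIntegrable K volume 0 t) :
    ∫ s in (0 : ℝ)..t, ∫ r in (0 : ℝ)..s, k s r * f r = ∫ r in (0 : ℝ)..t, K r * f r := by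
  set F : ℝ → ℝ → ℝ := fun s r => {p : ℝ × ℝ | p.2 ≤ p.1}.indicator
    (fun p => k p.1 p.2 * f p.2) (s, r) with hF
  have hFs : ∀ s, F s = (Iic s).indicator fun r => k s r * f r := fun s => by
    ext r; simp [hF, indicator]
  have hFr : ∀ r, (fun s => F s r) = (Ici r).indicator fun s => k s r * f r := fun r => by
    ext s; simp [hF, indicator]
  have hFm : Measurable (Function.uncurry F) := by
    have h1 : Measurable fun p : ℝ × ℝ => k p.1 p.2 * f p.2 := hk.mul (hf.comp measurable_snd)
    exact h1.indicator (measurableSet_le measurable_snd measurable_fst)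
  have hIcc : ∀ r ∈ Ioc 0 t, Ioc 0 t ∩ Ici r = Icc r t := fun r hr => by
    ext s
    simp only [mem_inter_iff, mem_Ioc, mem_Ici, mem_Icc]
    exact ⟨fun h => ⟨h.2, h.1.2⟩, fun h => ⟨⟨hr.1.trans_le h.1, h.2⟩, h.1⟩⟩
  have hIoc : ∀ s ∈ Ioc 0 t, Ioc 0 t ∩ Iic s = Ioc 0 s := fun s hs => by
    rw [Ioc_inter_Iic, min_eq_right hs.2]
  -- The kernel is nonnegative on the triangle, so integrating `|F|` in `s` gives `K r * |f r|`,
  -- with `K` integrable and `f` bounded.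
  have hint : Integrable (Function.uncurry F)
      ((volume.restrict (Ioc 0 t)).prod (volume.restrict (Ioc 0 t))) := by
    rw [integrable_prod_iff' hFm.aestronglyMeasurable]
    constructor
    · refine (ae_restrict_iff' measurableSet_Ioc).2 (Eventually.of_forall fun r hr => ?_)
      change Integrable (fun s => F s r) _
      rw [hFr, integrable_indicator_iff measurableSet_Ici, IntegrableOn,
        Measure.restrict_restrict measurableSet_Ici, inter_comm, hIcc r hr]
      change IntegrableOn _ _ _
      rw [integrableOn_Icc_iff_integrableOn_Ioc]
      exact ((intervalIntegrable_iff_integrableOn_Ioc_of_le hr.2).1 (hki r hr)).mul_const _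
    · have h1 : IntegrableOn (fun r => K r * |f r|) (Ioc 0 t) := by
        refine Integrable.mul_bdd (c := M)
          ((intervalIntegrable_iff_integrableOn_Ioc_of_le ht).1 hK)
          hf.abs.aestronglyMeasurable ?_
        refine (ae_restrict_iff' measurableSet_Ioc).2 (Eventually.of_forall fun r hr => ?_)
        simpa using hM r hr
      refine h1.congr_fun (fun r hr => ?_) measurableSet_Ioc
      have h2 : (fun s => ‖Function.uncurry F (s, r)‖) =
          (Ici r).indicator fun s => ‖k s r * f r‖ := by
        ext s
        change ‖(fun s => F s r) s‖ = _
        rw [hFr, norm_indicator_eq_indicator_norm]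
      simp only
      rw [h2, setIntegral_indicator measurableSet_Ici, hIcc r hr, integral_Icc_eq_integral_Ioc,
        ← hkK r hr, intervalIntegral.integral_of_le hr.2, ← integral_mul_const]
      refine setIntegral_congr_fun measurableSet_Ioc fun s hs => ?_
      simp only [norm_mul, Real.norm_eq_abs, abs_of_nonneg (hk0 s r hr.1 hs.1.le)]
  have hswap := integral_integral_swap hint
  rw [intervalIntegral.integral_of_le ht, intervalIntegral.integral_of_le ht]
  calc ∫ s in Ioc 0 t, ∫ r in (0 : ℝ)..s, k s r * f r
      = ∫ s in Ioc 0 t, ∫ r in Ioc 0 t, F s r := by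
        refine setIntegral_congr_fun measurableSet_Ioc fun s hs => ?_
        rw [hFs, setIntegral_indicator measurableSet_Iic, hIoc s hs,
          intervalIntegral.integral_of_le hs.1.le]
    _ = ∫ r in Ioc 0 t, ∫ s in Ioc 0 t, F s r := hswap
    _ = ∫ r in Ioc 0 t, K r * f r := by
        refine setIntegral_congr_fun measurableSet_Ioc fun r hr => ?_
        rw [hFr, setIntegral_indicator measurableSet_Ici, hIcc r hr, integral_Icc_eq_integral_Ioc,
          ← hkK r hr, intervalIntegral.integral_of_le hr.2, ← integral_mul_const]

theorem intervalIntegrable_log_div_pow (t : ℝ) (n : ℕ) :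
    IntervalIntegrable (fun r => Real.log (t / r) ^ n) volume 0 t := by
  have h := (intervalIntegrable_neg_log_rpow (n := (n : ℝ) + 1) (by positivity)).comp_mul_left
    (c := t⁻¹)
  simp only [div_inv_eq_mul, one_mul, add_sub_cancel_right, Real.rpow_natCast] at h
  rw [zero_mul] at h
  convert! h using 3 with r
  rw [← Real.log_inv, mul_inv, inv_inv, div_eq_mul_inv]

theorem integral_inv_mul_log_div_pow {t r : ℝ} (hr : r ∈ Ioc 0 t) (n : ℕ) :
    IntervalIntegrable (fun s => s⁻¹ * Real.log (s / r) ^ n) volume r t ∧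
      ∫ s in r..t, s⁻¹ * Real.log (s / r) ^ n = Real.log (t / r) ^ (n + 1) / (n + 1) := by
  have hpos : ∀ s ∈ uIcc r t, s ≠ 0 := fun s hs => by
    rw [uIcc_of_le hr.2] at hs
    exact (hr.1.trans_le hs.1).ne'
  have hi : IntervalIntegrable (fun s => s⁻¹ * Real.log (s / r) ^ n) volume r t := by
    refine ContinuousOn.intervalIntegrable fun s hs => ContinuousAt.continuousWithinAt ?_
    have h1 := hpos s hs
    have h2 : s / r ≠ 0 := div_ne_zero h1 hr.1.ne'
    exact (continuousAt_inv₀ h1).mul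
      (((continuousAt_id.div_const r).log h2).pow n)
  refine ⟨hi, ?_⟩
  rw [intervalIntegral.integral_eq_sub_of_hasDerivAt
    (f := fun s => Real.log (s / r) ^ (n + 1) / (n + 1)) (fun s hs => ?_) hi]
  · simp [div_self hr.1.ne']
  · have h1 := hpos s hs
    have h2 : s / r ≠ 0 := div_ne_zero h1 hr.1.ne'
    have h3 := ((((hasDerivAt_id s).div_const r).log h2).pow (n + 1)).div_const ((n : ℝ) + 1)
    convert! h3 using 1
    have := hr.1.ne'
    have h4 : (n : ℝ) + 1 ≠ 0 := by positivity
    simp only [id, Nat.add_sub_cancel]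
    push_cast
    field_simp

theorem integral_sub_pow (t r : ℝ) (n : ℕ) :
    ∫ s in r..t, (s - r) ^ n = (t - r) ^ (n + 1) / (n + 1) := by
  rw [intervalIntegral.integral_comp_sub_right (fun s => s ^ n) r, integral_pow]
  simp

variable {Ω : Type u} {X : ℝ≥0 → Ω → ℝ} {ω : Ω}

/-- Logarithmic analogue of Cauchy's formula: by Fubini one more average integrates `s⁻¹ log(s/r)^n`
over `[r, t]`, which raises the power of the logarithm by one. -/
theorem averageI_succ_eq (h0 : 0 ≤ X 0 ω) (hm : Monotone fun t => X t ω) (n : ℕ) (t : ℝ≥0) :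
    averageI X (n + 1) t ω = ((t : ℝ) * n.factorial)⁻¹ *
      ∫ s in (0 : ℝ)..t, Real.log ((t : ℝ) / s) ^ n * X s.toNNReal ω := by
  have hmono : Monotone fun s : ℝ => X s.toNNReal ω := fun a b hab =>
    hm (Real.toNNReal_mono hab)
  induction n generalizing t with
  | zero => simp [averageI, runningAverage, timeIntegral]
  | succ n ih =>
    -- At `t = 0` both prefactors are `0⁻¹ = 0`.
    rcases eq_or_ne t 0 with rfl | ht
    · rw [averageI, Function.iterate_succ_apply']
      simp [runningAverage]
    have ht' : (0 : ℝ) < t := by exact_mod_cast pos_iff_ne_zero.2 ht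
    have hswap := integral_triangle_swap (t := t) ht'.le (f := fun s => X s.toNNReal ω)
      hmono.measurable (M := X t ω) (fun r hr => ?_)
      (k := fun s r => s⁻¹ * Real.log (s / r) ^ n) ?_ (fun s r hr hrs => ?_)
      (fun r hr => (integral_inv_mul_log_div_pow hr n).1)
      (fun r hr => (integral_inv_mul_log_div_pow hr n).2)
      ((intervalIntegrable_log_div_pow t (n + 1)).div_const _)
    · have hstep : averageI X (n + 1 + 1) t ω = (t : ℝ)⁻¹ * ∫ s in (0 : ℝ)..t,
          averageI X (n + 1) s.toNNReal ω := by
        rw [averageI, Function.iterate_succ_apply']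
        rfl
      have hinner : ∫ s in (0 : ℝ)..t, averageI X (n + 1) s.toNNReal ω =
          ∫ s in (0 : ℝ)..t, (n.factorial : ℝ)⁻¹ * ∫ r in (0 : ℝ)..s,
            s⁻¹ * Real.log (s / r) ^ n * X r.toNNReal ω := by
        refine intervalIntegral.integral_congr fun s hs => ?_
        rw [uIcc_of_le ht'.le] at hs
        simp only [ih, Real.coe_toNNReal s hs.1, mul_assoc, intervalIntegral.integral_const_mul]
        rw [mul_inv]
        ring
      rw [hstep, hinner, intervalIntegral.integral_const_mul, hswap]
      simp_rw [div_mul_eq_mul_div]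
      rw [intervalIntegral.integral_div, Nat.factorial_succ]
      have h4 : (n : ℝ) + 1 ≠ 0 := by positivity
      push_cast
      field_simp
    · rw [abs_of_nonneg (h0.trans (hm zero_le))]
      exact hm (Real.toNNReal_le_iff_le_coe.2 hr.2)
    · exact measurable_fst.inv.mul ((Real.measurable_log.comp
        (measurable_fst.div measurable_snd)).pow_const n)
    · exact mul_nonneg (inv_nonneg.2 (hr.le.trans hrs))
        (pow_nonneg (Real.log_nonneg ((one_le_div hr).2 hrs)) n)

/-- Cauchy's formula for repeated integration, by the same exchange with kernel `(s - r)^n`. -/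
theorem timeIntegral_iterate_succ_eq (h0 : 0 ≤ X 0 ω) (hm : Monotone fun t => X t ω) (n : ℕ)
    (t : ℝ≥0) : (timeIntegral^[n + 1] X) t ω = (n.factorial : ℝ)⁻¹ *
      ∫ s in (0 : ℝ)..t, ((t : ℝ) - s) ^ n * X s.toNNReal ω := by
  have hmono : Monotone fun s : ℝ => X s.toNNReal ω := fun a b hab =>
    hm (Real.toNNReal_mono hab)
  induction n generalizing t with
  | zero => simp [timeIntegral]
  | succ n ih =>
    have hswap := integral_triangle_swap (t := t) t.coe_nonneg (f := fun s => X s.toNNReal ω)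
      hmono.measurable (M := X t ω) (fun r hr => ?_)
      (k := fun s r => (s - r) ^ n) (by fun_prop) (fun s r hr hrs => ?_)
      (fun r hr => (by fun_prop : Continuous fun s : ℝ => (s - r) ^ n).intervalIntegrable _ _)
      (fun r hr => integral_sub_pow t r n)
      ((by fun_prop : Continuous fun r : ℝ => ((t : ℝ) - r) ^ (n + 1) / (n + 1)).intervalIntegrable
        _ _)
    · have hstep : (timeIntegral^[n + 1 + 1] X) t ω = ∫ s in (0 : ℝ)..t,
          (timeIntegral^[n + 1] X) s.toNNReal ω := by
        rw [Function.iterate_succ_apply']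
        rfl
      have hinner : ∫ s in (0 : ℝ)..t, (timeIntegral^[n + 1] X) s.toNNReal ω =
          ∫ s in (0 : ℝ)..t, (n.factorial : ℝ)⁻¹ * ∫ r in (0 : ℝ)..s,
            (s - r) ^ n * X r.toNNReal ω := by
        refine intervalIntegral.integral_congr fun s hs => ?_
        rw [uIcc_of_le t.coe_nonneg] at hs
        simp only [ih, Real.coe_toNNReal s hs.1]
      rw [hstep, hinner, intervalIntegral.integral_const_mul, hswap]
      simp_rw [div_mul_eq_mul_div]
      rw [intervalIntegral.integral_div, Nat.factorial_succ]
      have h4 : (n : ℝ) + 1 ≠ 0 := by positivity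
      push_cast
      field_simp
    · rw [abs_of_nonneg (h0.trans (hm zero_le))]
      exact hm (Real.toNNReal_le_iff_le_coe.2 hr.2)
    · exact pow_nonneg (sub_nonneg.2 hrs) n

theorem averageI_eq_fracAverageI (h0 : 0 ≤ X 0 ω) (hm : Monotone fun t => X t ω) {n : ℕ}
    (hn : 1 ≤ n) (t : ℝ≥0) : averageI X n t ω = fracAverageI X n t ω := by
  obtain ⟨n, rfl⟩ := Nat.exists_eq_add_of_le' hn
  rw [averageI_succ_eq h0 hm, fracAverageI]
  push_cast
  simp only [add_sub_cancel_right, Real.rpow_natCast, Real.Gamma_nat_eq_factorial, mul_comm]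

theorem averageIII_eq_fracAverageIII (h0 : 0 ≤ X 0 ω) (hm : Monotone fun t => X t ω) {n : ℕ}
    (hn : 1 ≤ n) (t : ℝ≥0) : averageIII X n t ω = fracAverageIII X n t ω := by
  obtain ⟨n, rfl⟩ := Nat.exists_eq_add_of_le' hn
  rw [averageIII, timeIntegral_iterate_succ_eq h0 hm, fracAverageIII, Real.rpow_natCast]
  push_cast
  simp only [add_sub_cancel_right, Real.rpow_natCast, Real.Gamma_nat_eq_factorial, mul_inv,
    mul_assoc]

end IteratedAverages

/-! ### Rationality of the type I coefficients. -/

section Rationality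

/-- Differentiating term by term telescopes, leaving only the top power. -/
theorem hasDerivAt_mul_sum_neg_log {y : ℝ} (hy : y ≠ 0) (m : ℕ) :
    HasDerivAt (fun s => s * ∑ i ∈ Finset.range (m + 1), (-Real.log s) ^ i / (i.factorial : ℝ))
      ((-Real.log y) ^ m / (m.factorial : ℝ)) y := by
  induction m with
  | zero => simpa using hasDerivAt_id' y
  | succ m ih =>
    have h1 := (hasDerivAt_id y).mul
      (((Real.hasDerivAt_log hy).neg.pow (m + 1)).div_const ((m + 1).factorial : ℝ))
    have h2 := ih.add h1
    convert! h2 using 1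
    · ext s
      simp [Finset.sum_range_succ _ (m + 1), mul_add]
    · have h4 : (m : ℝ) + 1 ≠ 0 := by positivity
      have h5 : (m.factorial : ℝ) ≠ 0 := by positivity
      simp only [id, Nat.add_sub_cancel, Nat.factorial_succ, Pi.neg_apply, Pi.pow_apply]
      push_cast
      field_simp
      ring

theorem kernelI_natCast_succ (m : ℕ) {s : ℝ} (hs : s ∈ Ioc (0 : ℝ) 1) :
    kernelI ((m + 1 : ℕ) : ℝ) s =
      1 - s * ∑ i ∈ Finset.range (m + 1), (-Real.log s) ^ i / (i.factorial : ℝ) := by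
  rw [kernelI_eq_integral (by positivity) hs]
  push_cast
  simp only [add_sub_cancel_right, Real.rpow_natCast, Real.Gamma_nat_eq_factorial]
  have hne : ∀ y ∈ uIcc s 1, y ≠ 0 := fun y hy => by
    rw [uIcc_of_le hs.2] at hy
    exact (hs.1.trans_le hy.1).ne'
  rw [intervalIntegral.integral_eq_sub_of_hasDerivAt
    (fun y hy => hasDerivAt_mul_sum_neg_log (hne y hy) m)]
  · rw [Finset.sum_range_succ']
    simp
  · refine ContinuousOn.intervalIntegrable fun y hy => ContinuousAt.continuousWithinAt ?_
    exact ((Real.continuousAt_log (hne y hy)).neg.pow m).div_const _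

/-- All the moments `∫_0^1 (-log s)^j s^k h(s) ds` exist and are rational. -/
def HasRationalLogMoments (h : ℝ → ℝ) : Prop :=
  ∀ j k : ℕ, IntervalIntegrable (fun s => (-Real.log s) ^ j * s ^ k * h s) volume 0 1 ∧
    ∃ q : ℚ, ∫ s in (0 : ℝ)..1, (-Real.log s) ^ j * s ^ k * h s = q

namespace HasRationalLogMoments

theorem one : HasRationalLogMoments fun _ => 1 := fun j k => by
  have hj : (0 : ℝ) < (j : ℝ) + 1 := by positivity
  have h1 := (intervalIntegrable_neg_log_rpow hj).mul_continuousOn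
    (continuous_pow k).continuousOn
  have h2 := integral_neg_log_rpow_mul_pow hj k
  simp only [add_sub_cancel_right, Real.rpow_natCast, Real.Gamma_nat_eq_factorial] at h1 h2
  simp only [mul_one]
  refine ⟨h1, (j.factorial : ℚ) / ((k : ℚ) + 1) ^ (j + 1), ?_⟩
  rw [h2]
  push_cast
  rw [← Real.rpow_natCast]
  push_cast
  rfl

theorem sub {f g : ℝ → ℝ} (hf : HasRationalLogMoments f) (hg : HasRationalLogMoments g) :
    HasRationalLogMoments fun s => f s - g s := fun j k => by
  obtain ⟨hf1, q, hf2⟩ := hf j k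
  obtain ⟨hg1, r, hg2⟩ := hg j k
  simp only [mul_sub]
  refine ⟨hf1.sub hg1, q - r, ?_⟩
  rw [intervalIntegral.integral_sub hf1 hg1, hf2, hg2]
  push_cast
  rfl

theorem sum {ι : Type*} (s : Finset ι) {f : ι → ℝ → ℝ}
    (hf : ∀ i ∈ s, HasRationalLogMoments (f i)) :
    HasRationalLogMoments fun x => ∑ i ∈ s, f i x := fun j k => by
  simp only [Finset.mul_sum]
  have h1 := fun i hi => (hf i hi j k).1
  refine ⟨?_, ?_⟩
  · simpa [Finset.sum_fn] using IntervalIntegrable.sum s h1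
  · choose q hq using fun i : s => (hf i i.2 j k).2
    refine ⟨∑ i : s, q i, ?_⟩
    rw [intervalIntegral.integral_finsetSum h1, ← Finset.sum_coe_sort]
    push_cast
    exact Finset.sum_congr rfl fun i _ => hq i

theorem neg_log_pow_mul_mul {f : ℝ → ℝ} (hf : HasRationalLogMoments f) (i l : ℕ) (q : ℚ) :
    HasRationalLogMoments fun s => (q : ℝ) * ((-Real.log s) ^ i * s ^ l * f s) := fun j k => by
  obtain ⟨h1, r, h2⟩ := hf (j + i) (k + l)
  have heq : ∀ s : ℝ, (-Real.log s) ^ j * s ^ k * ((q : ℝ) * ((-Real.log s) ^ i * s ^ l * f s)) =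
      q * ((-Real.log s) ^ (j + i) * s ^ (k + l) * f s) := fun s => by ring
  simp only [heq]
  refine ⟨h1.const_mul _, q * r, ?_⟩
  rw [intervalIntegral.integral_const_mul, h2]
  push_cast
  rfl

/-- Multiplication by `s (-log s)^i` only shifts the moment indices; controlling all of them at once
makes the induction on `d` close. -/
theorem pow (m d : ℕ) : HasRationalLogMoments fun s =>
    (1 - s * ∑ i ∈ Finset.range (m + 1), (-Real.log s) ^ i / (i.factorial : ℝ)) ^ d := by
  induction d with
  | zero => simpa using one
  | succ d ih =>
    have h := ih.sub (sum (Finset.range (m + 1)) fun i _ =>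
      ih.neg_log_pow_mul_mul i 1 ((i.factorial : ℚ)⁻¹))
    convert! h using 2 with s
    rw [pow_succ, mul_sub, mul_one, Finset.mul_sum, Finset.mul_sum]
    congr 1
    refine Finset.sum_congr rfl fun i _ => ?_
    push_cast
    ring

end HasRationalLogMoments

theorem exists_rat_coeffI {n : ℕ} (hn : 1 ≤ n) (m : ℕ) : ∃ q : ℚ, coeffI n m = (q : ℝ) := by
  obtain ⟨n, rfl⟩ := Nat.exists_eq_add_of_le' hn
  obtain ⟨q, hq⟩ := (HasRationalLogMoments.pow n m 0 0).2
  refine ⟨q, ?_⟩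
  rw [← hq, coeffI]
  refine intervalIntegral.integral_congr_ae (Eventually.of_forall fun s hs => ?_)
  rw [uIoc_of_le zero_le_one] at hs
  rw [kernelI_natCast_succ n hs]
  simp

end Rationality

/-! ### Transfer to induced clocks and the second recipe. -/

section InducedClocks

variable {Ω : Type u} [MeasurableSpace Ω] {P : Measure Ω} {Ω' : Type v} [MeasurableSpace Ω']
  {P' : Measure Ω'} {A : Ω → ℝ} {W : Ω' → ℝ}

theorem cumulant_eq_of_identDistrib (h : IdentDistrib W A P' P) (m : ℕ) :
    cumulant W P' m = cumulant A P m := by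
  have : cgf W P' = cgf A P := by
    ext x
    rw [cgf, cgf, mgf_congr_of_identDistrib _ _ h]
  rw [cumulant, cumulant, this]

theorem HasCumulantExpansion.of_identDistrib (hA : HasCumulantExpansion A P)
    (h : IdentDistrib W A P' P) : HasCumulantExpansion W P' := by
  obtain ⟨ε, hε, hA⟩ := hA
  refine ⟨ε, hε, fun z hz => ?_⟩
  have hz' := h.comp (u := fun x : ℝ => Complex.exp (-z * (x : ℂ))) (by fun_prop)
  obtain ⟨h1, h2⟩ := hA z hz
  refine ⟨hz'.integrable_iff.2 h1, ?_⟩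
  have h3 : laplace W P' z = laplace A P z := hz'.integral_eq
  simpa only [h3, cumulant_eq_of_identDistrib h] using h2

theorem HasScaledCumulants.of_identDistrib {Ω'' : Type w} [MeasurableSpace Ω'']
    {P'' : Measure Ω''} {V : Ω'' → ℝ} {c : ℕ → ℝ} (hA : HasScaledCumulants A P V P'' c)
    (h : IdentDistrib W A P' P) : HasScaledCumulants W P' V P'' c :=
  ⟨hA.1.of_identDistrib h, fun m hm => by rw [cumulant_eq_of_identDistrib h, hA.2 m hm]⟩

variable [IsProbabilityMeasure P] {X : ℝ≥0 → Ω → ℝ}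

theorem hasScaledCumulants_averageI (hX : IsLevySubordinator X P)
    (hint : 0 ∈ interior (integrableExpSet (X 1) P)) {n : ℕ} (hn : 1 ≤ n) {t : ℝ≥0} (ht : 0 < t) :
    HasScaledCumulants (averageI X n t) P (X t) P (coeffI n) := by
  have hn' : (0 : ℝ) < n := by exact_mod_cast hn
  have hlaw := hasLawI_fracAverageI hX hint hn' ht
  refine (hlaw.hasScaledCumulants hX hint hn').of_identDistrib
    (IdentDistrib.of_ae_eq hlaw.aemeasurable ?_).symm
  filter_upwards [hX.start, hX.monotone] with ω h0 hm
  exact (averageI_eq_fracAverageI h0.ge hm hn t).symm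

theorem hasScaledCumulants_averageIII (hX : IsLevySubordinator X P)
    (hint : 0 ∈ interior (integrableExpSet (X 1) P)) {n : ℕ} (hn : 1 ≤ n) {t : ℝ≥0} (ht : 0 < t) :
    HasScaledCumulants (averageIII X n t) P (X t) P (coeffIII n) := by
  have hn' : (0 : ℝ) < n := by exact_mod_cast hn
  have hlaw := hasLawIII_fracAverageIII hX hint hn' ht
  refine (hlaw.hasScaledCumulants hX hint hn').of_identDistrib
    (IdentDistrib.of_ae_eq hlaw.aemeasurable ?_).symm
  filter_upwards [hX.start, hX.monotone] with ω h0 hm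
  exact (averageIII_eq_fracAverageIII h0.ge hm hn t).symm

/-- Type III at degree one, which serves as the single step of the second recipe. -/
theorem hasScaledCumulants_runningAverage (hX : IsLevySubordinator X P)
    (hint : 0 ∈ interior (integrableExpSet (X 1) P)) {t : ℝ≥0} (ht : 0 < t) :
    HasScaledCumulants (runningAverage X t) P (X t) P (fun m : ℕ => 1 / ((m : ℝ) + 1)) := by
  have h := hasScaledCumulants_averageIII hX hint le_rfl ht
  have h1 : averageIII X 1 t = runningAverage X t := by
    ext ω
    simp [averageIII, runningAverage]
  have h2 : coeffIII (1 : ℕ) = fun m : ℕ => 1 / ((m : ℝ) + 1) := by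
    ext m
    simp [coeffIII, Real.Gamma_add_one]
  rwa [h1, h2] at h

theorem coeffII_natCast_succ (n m : ℕ) :
    coeffII (n + 1 : ℕ) m = 1 / ((m : ℝ) + 1) * coeffII n m := by
  simp only [coeffII, Real.rpow_natCast]
  rw [pow_succ]
  field_simp

/-- Along the second recipe every clock is a subordinator with exponential moments whose cumulants
are those of `X`, divided by a power of `m + 1`. -/
theorem IsRecipeII.hasScaledCumulants {Ω' : ℕ → Type v} [∀ n, MeasurableSpace (Ω' n)]
    {P' : ∀ n, Measure (Ω' n)} [∀ n, IsProbabilityMeasure (P' n)] {Y : ∀ n, ℝ≥0 → Ω' n → ℝ}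
    (hY : IsRecipeII Y P' X P) (hX : IsLevySubordinator X P)
    (hint : 0 ∈ interior (integrableExpSet (X 1) P)) (n : ℕ) :
    (∀ t : ℝ≥0, 0 < t → HasScaledCumulants (Y n t) (P' n) (X t) P (coeffII n)) ∧
      ∀ t : ℝ≥0, 0 < t →
        HasScaledCumulants (runningAverage (Y n) t) (P' n) (X t) P (coeffII (n + 1 : ℕ)) := by
  have step : ∀ n : ℕ, IsLevySubordinator (Y n) (P' n) →
      (∀ t : ℝ≥0, 0 < t → HasScaledCumulants (Y n t) (P' n) (X t) P (coeffII n)) →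
      ∀ t : ℝ≥0, 0 < t →
        HasScaledCumulants (runningAverage (Y n) t) (P' n) (X t) P (coeffII (n + 1 : ℕ)) := by
    intro n hL h t ht
    -- `Y n` now plays the role of the base subordinator; its exponential moments come from the
    -- expansion already obtained for it.
    have hmem := (h 1 one_pos).1.laplaceDefinedNearZero.zero_mem_interior
    obtain ⟨h1, h2⟩ := hasScaledCumulants_runningAverage hL hmem ht
    refine ⟨h1, fun m hm => ?_⟩
    rw [h2 m hm, (h t ht).2 m hm, coeffII_natCast_succ]
    ring
  have hlevy : ∀ n, IsLevySubordinator (Y n) (P' n) := fun n => by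
    cases n with
    | zero => exact hY.zero.levy
    | succ n => exact (hY.succ n).levy
  have main : ∀ t : ℝ≥0, 0 < t → HasScaledCumulants (Y n t) (P' n) (X t) P (coeffII n) := by
    induction n with
    | zero =>
      intro t _
      refine HasScaledCumulants.of_identDistrib ?_ (hY.zero.law t)
      exact ⟨(hX.hasCumulantExpansion_and_cumulant hint t).1, fun m _ => by simp [coeffII]⟩
    | succ n ih =>
      intro t ht
      exact (step n (hlevy n) ih t ht).of_identDistrib ((hY.succ n).law t)
  exact ⟨main, step n (hlevy n) main⟩

end InducedClocks

end RegulatedClock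

theorem corollary2 {Ω : Type u} [MeasurableSpace Ω] (P : Measure Ω) [IsProbabilityMeasure P]
    (X : ℝ≥0 → Ω → ℝ) (hX : RegulatedClock.IsLevySubordinator X P)
    (hLT : ∀ t : ℝ≥0, 0 < t → RegulatedClock.LaplaceDefinedNearZero (X t) P) :
    -- the cumulants of the unregulated clock are the coefficients of its log-Laplace transform
    (∀ t : ℝ≥0, 0 < t → RegulatedClock.HasCumulantExpansion (X t) P) ∧
    -- integer degrees, first recipe: the averaged process and the induced Lévy process
    (∀ n : ℕ, 1 ≤ n → ∀ t : ℝ≥0, 0 < t →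
      RegulatedClock.HasScaledCumulants (RegulatedClock.averageI X n t) P (X t) P
        (RegulatedClock.coeffI n) ∧
      ∀ (Ω' : Type v) [MeasurableSpace Ω'] (P' : Measure Ω') [IsProbabilityMeasure P']
        (W : ℝ≥0 → Ω' → ℝ),
        RegulatedClock.IsInducedClock W P' (RegulatedClock.averageI X n) P →
        RegulatedClock.HasScaledCumulants (W t) P' (X t) P (RegulatedClock.coeffI n)) ∧
    -- integer degrees, second recipe: the averaged process and the induced Lévy process
    (∀ (Ω' : ℕ → Type w) [∀ n, MeasurableSpace (Ω' n)] (P' : ∀ n, Measure (Ω' n))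
      [∀ n, IsProbabilityMeasure (P' n)] (Y : ∀ n, ℝ≥0 → Ω' n → ℝ),
      RegulatedClock.IsRecipeII Y P' X P →
      ∀ n : ℕ, 1 ≤ n → ∀ t : ℝ≥0, 0 < t →
        RegulatedClock.HasScaledCumulants (RegulatedClock.runningAverage (Y (n - 1)) t) (P' (n - 1))
          (X t) P (RegulatedClock.coeffII n) ∧
        RegulatedClock.HasScaledCumulants (Y n t) (P' n) (X t) P (RegulatedClock.coeffII n)) ∧
    -- integer degrees, third recipe: the averaged process and the induced Lévy process
    (∀ n : ℕ, 1 ≤ n → ∀ t : ℝ≥0, 0 < t →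
      RegulatedClock.HasScaledCumulants (RegulatedClock.averageIII X n t) P (X t) P
        (RegulatedClock.coeffIII n) ∧
      ∀ (Ω' : Type v) [MeasurableSpace Ω'] (P' : Measure Ω') [IsProbabilityMeasure P']
        (W : ℝ≥0 → Ω' → ℝ),
        RegulatedClock.IsInducedClock W P' (RegulatedClock.averageIII X n) P →
        RegulatedClock.HasScaledCumulants (W t) P' (X t) P (RegulatedClock.coeffIII n)) ∧
    -- real degrees, clocks given by their Laplace transforms
    (∀ n : ℝ, 0 < n → ∀ t : ℝ≥0, 0 < t →
      ∀ (Ω' : Type v) [MeasurableSpace Ω'] (P' : Measure Ω') [IsProbabilityMeasure P']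
        (W : Ω' → ℝ),
        (RegulatedClock.HasLawI W P' X P n t →
          RegulatedClock.HasScaledCumulants W P' (X t) P (RegulatedClock.coeffI n)) ∧
        (RegulatedClock.HasLawII W P' X P n t →
          RegulatedClock.HasScaledCumulants W P' (X t) P (RegulatedClock.coeffII n)) ∧
        (RegulatedClock.HasLawIII W P' X P n t →
          RegulatedClock.HasScaledCumulants W P' (X t) P (RegulatedClock.coeffIII n))) ∧
    -- real degrees, pathwise fractional averages of types I and III
    (∀ n : ℝ, 0 < n → ∀ t : ℝ≥0, 0 < t →
      RegulatedClock.HasScaledCumulants (RegulatedClock.fracAverageI X n t) P (X t) P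
        (RegulatedClock.coeffI n) ∧
      RegulatedClock.HasScaledCumulants (RegulatedClock.fracAverageIII X n t) P (X t) P
        (RegulatedClock.coeffIII n)) ∧
    -- rationality of the type I coefficients at integer degrees
    (∀ n : ℕ, 1 ≤ n → ∀ m : ℕ, 1 ≤ m → ∃ q : ℚ, RegulatedClock.coeffI n m = (q : ℝ)) := by
  -- Exponential moments at time `1` give them at every time, the exponent being linear in time.
  have hint := (hLT 1 one_pos).zero_mem_interior
  refine ⟨fun t _ => (hX.hasCumulantExpansion_and_cumulant hint t).1, fun n hn t ht => ⟨?_, ?_⟩,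
    fun Ω' _ P' _ Y hY n hn t ht => ⟨?_, ?_⟩, fun n hn t ht => ⟨?_, ?_⟩,
    fun n hn t ht Ω' _ P' _ W => ⟨?_, ?_, ?_⟩, fun n hn t ht => ⟨?_, ?_⟩,
    fun n hn m _ => RegulatedClock.exists_rat_coeffI hn m⟩
  · exact RegulatedClock.hasScaledCumulants_averageI hX hint hn ht
  · intro Ω' _ P' _ W hW
    exact (RegulatedClock.hasScaledCumulants_averageI hX hint hn ht).of_identDistrib (hW.law t)
  · obtain ⟨n, rfl⟩ := Nat.exists_eq_add_of_le' hn
    exact (hY.hasScaledCumulants hX hint n).2 t ht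
  · exact (hY.hasScaledCumulants hX hint n).1 t ht
  · exact RegulatedClock.hasScaledCumulants_averageIII hX hint hn ht
  · intro Ω' _ P' _ W hW
    exact (RegulatedClock.hasScaledCumulants_averageIII hX hint hn ht).of_identDistrib (hW.law t)
  · exact fun h => h.hasScaledCumulants hX hint hn
  · exact fun h => h.hasScaledCumulants hX hint hn
  · exact fun h => h.hasScaledCumulants hX hint hn
  · exact (RegulatedClock.hasLawI_fracAverageI hX hint hn ht).hasScaledCumulants hX hint hn
  · exact (RegulatedClock.hasLawIII_fracAverageIII hX hint hn ht).hasScaledCumulants hX hint hn
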